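/- **Model.** A DC microgrid has an undirected connected graph on $n=n_s+n_l$ nodes, split into $n_s\ge1$ sources and $n_l\ge1$ loads. Each line $k$ has a resistance $r_k>0$; $B=\mathrm{col}(B_s,B_l)$ is an oriented incidence matrix, $\Gamma=\mathrm{diag}(r_k^{-1})$, and $$B\Gamma B^T=\begin{bmatrix}Y_{ss}&Y_{sl}\\Y_{ls}&Y_{ll}\end{bmatrix}.$$ The sources communicate over an undirected, unweighted, connected graph with Laplacian $L_c$. Let $C_s=\mathrm{diag}(C_1,\dots,C_{n_s})$ with $C_i>0$, and let $I_l^*,P_l^*\in\mathbb R^{n_l}_{\le0}$ and $Y_l^*\ge0$ diagonal be the constant-current, constant-power and constant-impedance parts of the loads. Write $[v]$ for the diagonal matrix with diagonal $v$ and $V=\mathrm{col}(V_s,V_l)$. Put $$P_s(V)=[V_s](Y_{ss}V_s+Y_{sl}V_l),\qquad I_l(V_l)=I_l^*-Y_l^*V_l+[V_l]^{-1}P_l^* .$$ The closed-loop system is the differential-algebraic system $$C_s\dot V_s=-[V_s]L_cC_s^{-1}P_s(V),\qquad I_l(V_l)=Y_{ls}V_s+Y_{ll}V_l. \tag{1}$$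 A solution of (1) on an interval is a continuous function $V$ with $V_s$ differentiable that satisfies (1) there. **Equilibria.** Let $\mathcal I_{ZIP}(V)=I_l(V_l)-Y_{ll}V_l-Y_{ls}V_s$, $Y_{red}=Y_{ss}-Y_{sl}Y_{ll}^{-1}Y_{ls}$ and $$\mathcal P_{ZIP}(V)=[V_s]Y_{red}V_s+[V_s]Y_{sl}Y_{ll}^{-1}I_l(V_l)+C_s\mathbb 1\,\frac{\mathbb 1^TI_l(V_l)}{\mathbb 1^T[V_s]^{-1}C_s\mathbb 1},$$ and let $\mathcal E_{ZIP}=\{V\in\mathbb R^n_{>0}:\ \mathcal I_{ZIP}(V)=0,\ \mathcal P_{ZIP}(V)=0\}$ be the set of equilibria of (1). **Bregman function.** For $\overline V\in\mathcal E_{ZIP}$ let $\overline P_s=P_s(\overline V)$ and, for $V\in\mathbb R^n_{>0}$, $$M(V)=\tfrac12V^T\Big(B\Gamma B^T+\begin{bmatrix}0&0\\0&Y_l^*\end{bmatrix}\Big)V-\sum_{i}\overline P_{s,i}\ln V_{s,i}-\sum_{i}P^*_{l,i}\ln V_{l,i},$$ $$\mathcal M(V)=M(V)-M(\overline V)-\nabla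 M(\overline V)^T(V-\overline V).$$ The sublevel set of $\mathcal M$ around $\overline V$ at level $c$ is the connected component containing $\overline V$ of $\{V\in\mathbb R^n_{>0}:\mathcal M(V)\le c\}$. **Theorem.** Assume that $\overline V\in\mathcal E_{ZIP}$ satisfies $$Y_{ll}+Y_l^*+[\overline V_l]^{-2}[P_l^*]-Y_{ls}\big(Y_{ss}+[\overline V_s]^{-2}[\overline P_s]\big)^{-1}Y_{sl}>0$$ (positive definite). Then there is a level $c>0$ such that the sublevel set $\Lambda_{ZIP}$ of $\mathcal M$ around $\overline V$ at level $c$ is a compact subset of $\mathbb R^n_{>0}$ and a neighbourhood of $\overline V$, and the following hold. 1. For each $V_0\in\Lambda_{ZIP}$ with $\mathcal I_{ZIP}(V_0)=0$ there is a solution of (1) on $[0,\infty)$ with $V(0)=V_0$; and each solution of (1) on an interval $[0,T)$, $0<T<\infty$, with $V(0)\in\Lambda_{ZIP}$ extends to a solution on $[0,\infty)$. 2. For each solution $V$ of (1) on $[0,\infty)$ with $V(0)\in\Lambda_{ZIP}$ and all $t\ge0$: $V(t)\in\Lambda_{ZIP}$, all entries of $V(t)$ are positive, and $\prod_{i=1}^{n_s}V_i(t)^{C_i}=\prod_{i=1}^{n_s}V_i(0)^{C_i}$.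 3. For each such $V$, the distance of $V(t)$ to the set $\mathcal E_{ZIP}\cap\Lambda_{ZIP}\cap\mathcal V_{ZIP}$ tends to $0$ as $t\to\infty$ (in particular this set is non-empty), where $$\mathcal V_{ZIP}=\Big\{V\in\Lambda_{ZIP}:\ \mathcal I_{ZIP}(V)=0,\ \prod_{i=1}^{n_s}V_i^{C_i}=\prod_{i=1}^{n_s}V_i(0)^{C_i}\Big\}.$$ -/

import Mathlib

open Set Filter Topology Matrix

/-- Data of a resistive DC microgrid with sources `S`, ZIP loads `L` and a communication network
among the sources. -/
structure Microgrid (S L : Type*) where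
  /-- The electrical network: an undirected connected graph on sources and loads. -/
  grid : SimpleGraph (S ⊕ L)
  grid_connected : grid.Connected
  /-- An (arbitrary) orientation of the lines, used to write the incidence matrix. -/
  tail : grid.edgeSet → S ⊕ L
  head : grid.edgeSet → S ⊕ L
  edge_eq : ∀ e : grid.edgeSet, e.val = s(tail e, head e)
  /-- Line resistances. -/
  r : grid.edgeSet → ℝ
  r_pos : ∀ e, 0 < r e
  /-- The communication network: an undirected connected graph on the sources. -/
  comm : SimpleGraph S
  comm_connected : comm.Connected
  /-- Controller parameters. -/
  C : S → ℝ
  C_pos : ∀ i, 0 < C i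
  /-- Constant current part of the loads. -/
  Istar : L → ℝ
  Istar_nonpos : ∀ i, Istar i ≤ 0
  /-- Load conductances (diagonal entries of the matrix of constant impedance loads). -/
  Ystar : L → ℝ
  Ystar_nonneg : ∀ i, 0 ≤ Ystar i
  /-- Constant power part of the loads. -/
  Pstar : L → ℝ
  Pstar_nonpos : ∀ i, Pstar i ≤ 0

namespace Microgrid

/-- Source voltages of a voltage vector `V = col(V_s, V_l)`. -/
def src {S L : Type*} (V : S ⊕ L → ℝ) : S → ℝ := fun i => V (Sum.inl i)

/-- Load voltages of a voltage vector `V = col(V_s, V_l)`. -/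
def load {S L : Type*} (V : S ⊕ L → ℝ) : L → ℝ := fun i => V (Sum.inr i)

/-- The positive orthant. -/
def posOrthant (N : Type*) : Set (N → ℝ) := {V | ∀ i, 0 < V i}

noncomputable section

open scoped Classical in
/-- Oriented incidence matrix of the electrical network. -/
def incidence {S L : Type*} (G : Microgrid S L) : Matrix (S ⊕ L) G.grid.edgeSet ℝ :=
  Matrix.of fun v e => (if v = G.head e then 1 else 0) - (if v = G.tail e then 1 else 0)

variable {S L : Type*} [Fintype S] [Fintype L] [DecidableEq S] [DecidableEq L]

open scoped Classical in
/-- The conductance matrix `B Γ Bᵀ`, with `Γ` the diagonal matrix of line conductances. -/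
def Y (G : Microgrid S L) : Matrix (S ⊕ L) (S ⊕ L) ℝ :=
  G.incidence * Matrix.diagonal (fun e => (G.r e)⁻¹) * G.incidenceᵀ

/-- The blocks of the conductance matrix. -/
def Yss (G : Microgrid S L) : Matrix S S ℝ := G.Y.toBlocks₁₁
def Ysl (G : Microgrid S L) : Matrix S L ℝ := G.Y.toBlocks₁₂
def Yls (G : Microgrid S L) : Matrix L S ℝ := G.Y.toBlocks₂₁
def Yll (G : Microgrid S L) : Matrix L L ℝ := G.Y.toBlocks₂₂

/-- The Kron-reduced conductance matrix. -/
def Yred (G : Microgrid S L) : Matrix S S ℝ := G.Yss - G.Ysl * G.Yll⁻¹ * G.Yls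

open scoped Classical in
/-- The Laplacian (degree matrix minus adjacency matrix) of the communication graph. -/
def Lc (G : Microgrid S L) : Matrix S S ℝ := G.comm.lapMatrix ℝ

/-- Source power injections `P_s = [V_s] (Y_ss V_s + Y_sl V_l)`. -/
def sourcePower (G : Microgrid S L) (V : S ⊕ L → ℝ) : S → ℝ :=
  src V * (G.Yss *ᵥ src V + G.Ysl *ᵥ load V)

/-- ZIP load currents `I_l(V_l) = I_l^* - Y_l^* V_l + [V_l]⁻¹ P_l^*`. -/
def loadCurrent (G : Microgrid S L) (Vl : L → ℝ) : L → ℝ :=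
  G.Istar - Matrix.diagonal G.Ystar *ᵥ Vl + Matrix.diagonal (fun i => (Vl i)⁻¹) *ᵥ G.Pstar

/-- Solutions on the time interval `J` of the closed-loop differential-algebraic system
`C_s V̇_s = -[V_s] L_c C_s⁻¹ P_s`, `-I_l(V_l) = -(Y_ls V_s + Y_ll V_l)`: continuous trajectories
whose source voltages are differentiable (one-sidedly at an end point of `J`) and which satisfy
both equations on `J`. Neither positivity nor boundedness of the voltages is part of the
definition. -/
structure IsSolutionOn (G : Microgrid S L) (J : Set ℝ) (V : ℝ → S ⊕ L → ℝ) : Prop where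
  continuousOn : ContinuousOn V J
  source : ∀ t ∈ J, ∃ dVs : S → ℝ,
    HasDerivWithinAt (fun τ => src (V τ)) dVs J t ∧
      Matrix.diagonal G.C *ᵥ dVs =
        -((Matrix.diagonal (src (V t)) * G.Lc * Matrix.diagonal (fun i => (G.C i)⁻¹)) *ᵥ
            G.sourcePower (V t))
  algebraic : ∀ t ∈ J,
    -G.loadCurrent (load (V t)) = -(G.Yls *ᵥ src (V t) + G.Yll *ᵥ load (V t))

/-- Current balance at the loads. -/
def currentBalance (G : Microgrid S L) (V : S ⊕ L → ℝ) : L → ℝ :=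
  G.loadCurrent (load V) - G.Yll *ᵥ load V - G.Yls *ᵥ src V

/-- The steady-state source injections `- C_s 𝟙 (𝟙ᵀ I_l(V_l)) / (𝟙ᵀ [V_s]⁻¹ C_s 𝟙)`. -/
def steadyPower (G : Microgrid S L) (V : S ⊕ L → ℝ) : S → ℝ :=
  fun i => -(G.C i * ((∑ j, G.loadCurrent (load V) j) / ∑ j, (src V j)⁻¹ * G.C j))

/-- Power balance at the sources. -/
def powerBalance (G : Microgrid S L) (V : S ⊕ L → ℝ) : S → ℝ :=
  src V * (G.Yred *ᵥ src V) + src V * ((G.Ysl * G.Yll⁻¹) *ᵥ G.loadCurrent (load V))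
    - G.steadyPower V

/-- The equilibrium set `ℰ_ZIP`. -/
def equilibria (G : Microgrid S L) : Set (S ⊕ L → ℝ) :=
  {V | V ∈ posOrthant (S ⊕ L) ∧ G.currentBalance V = 0 ∧ G.powerBalance V = 0}

/-- The positive definiteness condition
`Y_ll + Y_l^* + [V̄_l]⁻² [P_l^*] - Y_ls (Y_ss + [V̄_s]⁻² [P̄_s])⁻¹ Y_sl > 0`, where `P̄_s` is the
source power injection at `V̄`. -/
def MainCondition (G : Microgrid S L) (Vbar : S ⊕ L → ℝ) : Prop :=
  (G.Yll + Matrix.diagonal G.Ystar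
    + Matrix.diagonal (fun i => (load Vbar i ^ 2)⁻¹ * G.Pstar i)
    - G.Yls * (G.Yss + Matrix.diagonal (fun i => (src Vbar i ^ 2)⁻¹ * G.sourcePower Vbar i))⁻¹
        * G.Ysl).PosDef

/-- The energy function `M = J + H + K` associated with `V̄`. -/
def energy (G : Microgrid S L) (Vbar V : S ⊕ L → ℝ) : ℝ :=
  (1 / 2) * (V ⬝ᵥ ((G.Y + Matrix.fromBlocks 0 0 0 (Matrix.diagonal G.Ystar)) *ᵥ V))
    - ∑ i, G.sourcePower Vbar i * Real.log (src V i)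
    - ∑ i, G.Pstar i * Real.log (load V i)

/-- The Bregman function `ℳ` of the energy function, centred at `V̄`. -/
def bregman (G : Microgrid S L) (Vbar V : S ⊕ L → ℝ) : ℝ :=
  G.energy Vbar V - G.energy Vbar Vbar - fderiv ℝ (G.energy Vbar) Vbar (V - Vbar)

/-- The sublevel set of `ℳ` around `V̄` at level `c`: the connected component containing `V̄` of
`{V > 0 : ℳ(V) ≤ c}`. (With constant power loads `ℳ` tends to `-∞` as a load voltage tends
to `0`, so only the part of the sublevel set around `V̄` can be compact.) -/
def sublevel (G : Microgrid S L) (Vbar : S ⊕ L → ℝ) (c : ℝ) : Set (S ⊕ L → ℝ) :=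
  connectedComponentIn {V | V ∈ posOrthant (S ⊕ L) ∧ G.bregman Vbar V ≤ c} Vbar

/-- The weighted geometric mean `∏ V_i ^ C_i` of the source voltages. -/
def geomMean (G : Microgrid S L) (V : S ⊕ L → ℝ) : ℝ := ∏ i, src V i ^ G.C i

/-- The set `𝒱_ZIP` for the set `Λ` and the initial condition `V0`. -/
def meanSet (G : Microgrid S L) (Λ : Set (S ⊕ L → ℝ)) (V0 : S ⊕ L → ℝ) : Set (S ⊕ L → ℝ) :=
  {V | V ∈ Λ ∧ G.currentBalance V = 0 ∧ G.geomMean V = G.geomMean V0}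

end

end Microgrid

/-! The Bregman function `ℳ` is a strict Lyapunov function, up to one conserved quantity. All
injected currents sum to zero and the load currents are nonpositive at positive voltages, so at `V̄`
the source powers are `κ C_i` with a single `κ ≥ 0`. Hence the source components of `∇ℳ` are `V_i⁻¹
(P_i - κ C_i)`, and its load components are minus the current balance, which vanishes along
solutions. With `u = C⁻¹ P_s` the chain rule gives `dℳ/dt = -(u - κ𝟙)ᵀ L_c u = -uᵀ L_c u ≤ 0`,
because `L_c` annihilates constants (`sum_gradient_mul_vectorField`). The same fact conserves `∑ C_i
ln V_i`.

The assumed matrix inequality is a Schur complement condition; as `κ ≥ 0` makes the source block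
positive definite, the Hessian at `V̄` is positive definite (`hessian_pos`), and `∇ℳ` is strongly
monotone on a ball (`exists_stronglyConvexBall`). This monotonicity is used twice. It makes `ℳ` grow
along rays, so small sublevel sets are star-shaped, compact and inside the open ball
(`sublevel_eq`). And since the load gradient vanishes on the load manifold, it bounds voltage
differences there by source differences (`exists_norm_sub_le`), which turns the
differential-algebraic system into a Lipschitz ODE for the sources and allows a chain rule without
differentiability of the loads.

A bounded Lipschitz extension of that ODE has global curves. A continuation argument in time keeps
them in the sublevel set and on the load manifold (`mem_sublevel_of_mem`), where they solve the
original system. Convergence follows from Barbalat's lemma: the dissipation tends to zero, and on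
the compact invariant set its zeros are equilibria, since the communication graph is connected. -/

/-! ### Auxiliary analysis: global flows, Barbalat's lemma, Lipschitz extension -/

/-- A bounded Lipschitz vector field has a global integral curve through every point. -/
theorem exists_forall_hasDerivAt_of_lipschitzWith_of_norm_le {E : Type*} [NormedAddCommGroup E]
    [NormedSpace ℝ E] [CompleteSpace E] {F : E → E} {K B : NNReal} (hF : LipschitzWith K F)
    (hB : ∀ x, ‖F x‖ ≤ B) (x₀ : E) :
    ∃ y : ℝ → E, y 0 = x₀ ∧ ∀ t, HasDerivAt y (F (y t)) t := by
  have key : ∀ n : ℕ, ∃ α : ℝ → E, α 0 = x₀ ∧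
      ∀ t ∈ Ioo (-((n : ℝ) + 1)) (n + 1), HasDerivAt α (F (α t)) t := by
    intro n
    have hn : (0 : ℝ) ≤ n := n.cast_nonneg
    have h0 : (0 : ℝ) ∈ Icc (-((n : ℝ) + 1)) (n + 1) := ⟨by linarith, by linarith⟩
    -- A speed of at most `B` cannot leave the ball of radius `B * (n + 1)` within time `n + 1`, so
    -- the existence time is not shortened.
    have hPL : IsPicardLindelof (fun _ => F) (⟨0, h0⟩ : Icc (-((n : ℝ) + 1)) (n + 1)) x₀
        (B * (n + 1)) 0 B K :=
      { lipschitzOnWith := fun _ _ => hF.lipschitzOnWith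
        continuousOn := fun _ _ => continuousOn_const
        norm_le := fun _ _ x _ => hB x
        mul_max_le := by simp }
    obtain ⟨α, hα0, hα⟩ := hPL.exists_eq_forall_mem_Icc_hasDerivWithinAt₀
    exact ⟨α, hα0, fun t ht => (hα t (Ioo_subset_Icc_self ht)).hasDerivAt (Icc_mem_nhds ht.1 ht.2)⟩
  choose α hα0 hα using key
  have agree : ∀ n m : ℕ, n ≤ m → EqOn (α n) (α m) (Ioo (-((n : ℝ) + 1)) (n + 1)) := by
    intro n m hnm
    have hn : (0 : ℝ) ≤ n := n.cast_nonneg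
    have hnm' : (n : ℝ) ≤ m := by exact_mod_cast hnm
    refine ODE_solution_unique_of_mem_Ioo (v := fun _ => F) (s := fun _ => univ) (K := K) (t₀ := 0)
      (fun _ _ => hF.lipschitzOnWith) ⟨by linarith, by linarith⟩ (fun t ht => ⟨hα n t ht, trivial⟩)
      (fun t ht => ⟨hα m t ⟨by linarith [ht.1], by linarith [ht.2]⟩, trivial⟩) (by simp [hα0])
  -- The curve of index `n` lives on a half-length `n + 1`, so the index `⌈|t|⌉₊` leaves room on
  -- both sides of `t`.
  refine ⟨fun t => α ⌈|t|⌉₊ t, by simp [hα0], fun t => ?_⟩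
  have eq_of_lt : ∀ (N : ℕ) (τ : ℝ), |τ| < N → α ⌈|τ|⌉₊ τ = α N τ := by
    intro N τ hτ
    refine agree _ _ (Nat.ceil_le.2 hτ.le) ?_
    have := Nat.le_ceil |τ|
    exact abs_lt.1 (by linarith)
  have htN : |t| < ((⌈|t|⌉₊ + 1 : ℕ) : ℝ) := by
    push_cast
    linarith [Nat.le_ceil |t|]
  have hev : (fun τ => α ⌈|τ|⌉₊ τ) =ᶠ[𝓝 t] α (⌈|t|⌉₊ + 1) := by
    filter_upwards [(continuous_abs.continuousAt (x := t)).eventually_lt continuousAt_const htN]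
      with τ hτ using eq_of_lt _ _ hτ
  have hd := hα (⌈|t|⌉₊ + 1) t (abs_lt.1 (by linarith))
  rw [← eq_of_lt _ _ htN] at hd
  exact hd.congr_of_eventuallyEq hev

/-- Barbalat's lemma: a nonnegative Lipschitz dissipation rate of a function bounded below
tends to `0`. -/
theorem tendsto_zero_of_dissipation {f w : ℝ → ℝ} {K : NNReal} {b : ℝ}
    (hf : ∀ t ∈ Ici (0 : ℝ), HasDerivWithinAt f (-w t) (Ici 0) t)
    (hw : ∀ t ∈ Ici (0 : ℝ), 0 ≤ w t) (hlip : LipschitzOnWith K w (Ici 0))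
    (hb : ∀ t ∈ Ici (0 : ℝ), b ≤ f t) : Tendsto w atTop (𝓝 0) := by
  have hcont : ContinuousOn f (Ici 0) := fun t ht => (hf t ht).continuousWithinAt
  have hderiv : ∀ t ∈ interior (Ici (0 : ℝ)), HasDerivWithinAt f (-w t) (interior (Ici 0)) t :=
    fun t ht => (hf t (interior_subset ht)).mono interior_subset
  have hanti : AntitoneOn f (Ici 0) :=
    antitoneOn_of_hasDerivWithinAt_nonpos (convex_Ici 0) hcont hderiv
      fun t ht => neg_nonpos.2 (hw t (interior_subset ht))
  by_contra hnot
  obtain ⟨ε, hε, hfreq⟩ : ∃ ε > 0, ∀ T, ∃ t ≥ T, ε ≤ |w t| := by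
    rw [Metric.tendsto_atTop] at hnot
    push Not at hnot
    simpa [Real.dist_eq] using hnot
  -- With this `δ` the rate loses at most `ε / 2` over time `δ`; the `+ 1` covers `K = 0`.
  set δ : ℝ := ε / (2 * (K + 1)) with hδ
  have hK : (0 : ℝ) ≤ K := K.coe_nonneg
  have hδ0 : 0 < δ := by positivity
  have hKδ : K * δ ≤ ε / 2 := by
    rw [hδ, mul_div_assoc', div_le_div_iff₀ (by positivity) (by positivity)]
    nlinarith
  have drop : ∀ s ∈ Ici (0 : ℝ), ε ≤ w s → f (s + δ) ≤ f s - δ * (ε / 2) := by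
    intro s hs hws
    have hsub : Icc s (s + δ) ⊆ Ici 0 := fun t ht => le_trans hs ht.1
    -- Adding the linear term replaces integration of `w ≥ ε / 2` over the interval. Each visit of
    -- `w` above `ε` thus costs `f` a fixed amount, which a lower bound permits only finitely often.
    have : AntitoneOn (fun t => f t + t * (ε / 2)) (Icc s (s + δ)) := by
      refine antitoneOn_of_hasDerivWithinAt_nonpos (f' := fun t => -w t + 1 * (ε / 2))
        (convex_Icc _ _) ((hcont.mono hsub).add (by fun_prop)) (fun t ht => ?_) (fun t ht => ?_)
      · exact ((hf t (hsub (interior_subset ht))).mono (interior_subset.trans hsub)).add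
          ((hasDerivWithinAt_id _ _).mul_const _)
      · have ht' := interior_subset ht
        have h1 := hlip.dist_le_mul t (hsub ht') s hs
        rw [Real.dist_eq, Real.dist_eq, abs_of_nonneg (sub_nonneg.2 ht'.1)] at h1
        have h2 := (abs_le.1 h1).1
        have h3 : K * (t - s) ≤ K * δ := by gcongr; linarith [ht'.2]
        linarith
    have := this ⟨le_rfl, by linarith⟩ ⟨by linarith, le_rfl⟩ (by linarith : s ≤ s + δ)
    simp only at this
    linarith
  have iter : ∀ n : ℕ, ∃ t ∈ Ici (0 : ℝ), f t ≤ f 0 - n * (δ * (ε / 2)) := by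
    intro n
    induction n with
    | zero => exact ⟨0, self_mem_Ici, by simp⟩
    | succ n ih =>
      obtain ⟨t, ht, hft⟩ := ih
      obtain ⟨s, hs, hws⟩ := hfreq t
      have hs0 : s ∈ Ici (0 : ℝ) := le_trans ht hs
      rw [abs_of_nonneg (hw s hs0)] at hws
      have h1 := drop s hs0 hws
      have h2 := hanti ht hs0 hs
      refine ⟨s + δ, mem_Ici.2 (by linarith [mem_Ici.1 hs0]), ?_⟩
      push_cast
      linarith
  obtain ⟨n, hn⟩ := exists_nat_gt ((f 0 - b) / (δ * (ε / 2)))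
  obtain ⟨t, ht, hft⟩ := iter n
  rw [div_lt_iff₀ (by positivity)] at hn
  linarith [hb t ht]

/-- A trajectory in a compact set along which a continuous function tends to `0` approaches the
zero set of that function. -/
theorem tendsto_infEDist_of_tendsto_zero {X : Type*} [PseudoEMetricSpace X] {K : Set X}
    (hK : IsCompact K) {q : X → ℝ} (hq : ContinuousOn q K) {V : ℝ → X}
    (hV : ∀ t, 0 ≤ t → V t ∈ K) (hlim : Tendsto (fun t => q (V t)) atTop (𝓝 0)) :
    Tendsto (fun t => Metric.infEDist (V t) {x ∈ K | q x = 0}) atTop (𝓝 0) := by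
  rw [ENNReal.tendsto_nhds_zero]
  intro ε hε
  by_contra hnot
  rw [not_eventually] at hnot
  obtain ⟨t, ht, hbad⟩ := exists_seq_forall_of_frequently (hnot.and_eventually (eventually_ge_atTop 0))
  obtain ⟨x, hx, φ, hφ, hconv⟩ := hK.tendsto_subseq fun n => hV (t n) (hbad n).2
  have hwithin : Tendsto (V ∘ t ∘ φ) atTop (𝓝[K] x) :=
    tendsto_nhdsWithin_iff.2 ⟨hconv, Eventually.of_forall fun n => hV _ (hbad (φ n)).2⟩
  have hqx : q x = 0 :=
    tendsto_nhds_unique ((hq x hx).tendsto.comp hwithin) (hlim.comp (ht.comp hφ.tendsto_atTop))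
  have hd : Tendsto (fun n => edist (V (t (φ n))) x) atTop (𝓝 0) :=
    tendsto_iff_edist_tendsto_0.1 hconv
  obtain ⟨n, hn⟩ := ((ENNReal.tendsto_nhds_zero.1 hd) ε hε).exists
  have hmem : x ∈ {x ∈ K | q x = 0} := ⟨hx, hqx⟩
  exact (hbad (φ n)).1 ((Metric.infEDist_le_edist_of_mem hmem).trans hn)

/-- A positive definite quadratic form dominates a multiple of the squared norm. -/
theorem exists_pos_mul_sq_norm_le_dotProduct {N : Type*} [Fintype N] (H : Matrix N N ℝ)
    (hH : ∀ d : N → ℝ, d ≠ 0 → 0 < d ⬝ᵥ H *ᵥ d) :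
    ∃ m > 0, ∀ d : N → ℝ, m * ‖d‖ ^ 2 ≤ d ⬝ᵥ H *ᵥ d := by
  have hcont : Continuous fun d : N → ℝ => d ⬝ᵥ H *ᵥ d := by
    unfold dotProduct mulVec dotProduct
    fun_prop
  rcases (Metric.sphere (0 : N → ℝ) 1).eq_empty_or_nonempty with hempty | hne
  · refine ⟨1, one_pos, fun d => ?_⟩
    have hd : d = 0 := by
      by_contra hd
      have : ‖d‖⁻¹ • d ∈ Metric.sphere (0 : N → ℝ) 1 := by
        simp [norm_smul, inv_mul_cancel₀ (norm_ne_zero_iff.2 hd)]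
      simp [hempty] at this
    simp [hd]
  · obtain ⟨e, he, hmin⟩ := (isCompact_sphere (0 : N → ℝ) 1).exists_isMinOn hne hcont.continuousOn
    have he0 : e ≠ 0 := by
      rintro rfl
      simp at he
    refine ⟨_, hH e he0, fun d => ?_⟩
    rcases eq_or_ne d 0 with rfl | hd
    · simp
    have hd' := norm_ne_zero_iff.2 hd
    have hmem : ‖d‖⁻¹ • d ∈ Metric.sphere (0 : N → ℝ) 1 := by
      simp [norm_smul, inv_mul_cancel₀ hd']
    have := isMinOn_iff.1 hmin _ hmem
    simp only [smul_dotProduct, mulVec_smul, dotProduct_smul, smul_eq_mul] at this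
    calc (e ⬝ᵥ H *ᵥ e) * ‖d‖ ^ 2 ≤ (‖d‖⁻¹ * (‖d‖⁻¹ * (d ⬝ᵥ H *ᵥ d))) * ‖d‖ ^ 2 := by gcongr
      _ = d ⬝ᵥ H *ᵥ d := by field_simp

/-- A bounded Lipschitz function on a subset has a bounded Lipschitz extension. -/
theorem LipschitzOnWith.exists_bounded_extension {α ι : Type*} [PseudoMetricSpace α] [Fintype ι]
    {f : α → ι → ℝ} {s : Set α} {K : NNReal} (hf : LipschitzOnWith K f s) {B : NNReal}
    (hB : ∀ x ∈ s, ‖f x‖ ≤ B) :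
    ∃ g : α → ι → ℝ, LipschitzWith K g ∧ (∀ x, ‖g x‖ ≤ B) ∧ EqOn f g s := by
  obtain ⟨g, hg, hfg⟩ := hf.extend_pi
  -- Truncating each coordinate to `[-B, B]` is 1-Lipschitz and changes nothing on `s`.
  refine ⟨fun x i => max (-B) (min B (g x i)), ?_, fun x => ?_, fun x hx => ?_⟩
  · rw [lipschitzWith_iff_dist_le_mul]
    intro x y
    refine (dist_pi_le_iff (by positivity)).2 fun i => ?_
    refine le_trans ?_ ((dist_le_pi_dist _ _ i).trans (hg.dist_le_mul x y))
    rw [Real.dist_eq, Real.dist_eq]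
    refine (abs_max_sub_max_le_max _ _ _ _).trans (max_le (by simp) ?_)
    exact (abs_min_sub_min_le_max _ _ _ _).trans (max_le (by simp) le_rfl)
  · refine (pi_norm_le_iff_of_nonneg B.coe_nonneg).2 fun i => ?_
    rw [Real.norm_eq_abs, abs_le]
    exact ⟨le_max_left _ _, max_le (by linarith [B.coe_nonneg]) (min_le_left _ _)⟩
  · funext i
    have h1 := (norm_le_pi_norm (f x) i).trans (hB x hx)
    rw [Real.norm_eq_abs, abs_le] at h1
    change _ = max (-(B : ℝ)) (min B (g x i))
    rw [← hfg hx, min_eq_right h1.2, max_eq_right h1.1]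

/-- A chain rule along a Lipschitz curve that need not be differentiable itself. -/
theorem HasFDerivAt.hasDerivWithinAt_comp_of_isBigO {E : Type*} [NormedAddCommGroup E]
    [NormedSpace ℝ E] {φ : E → ℝ} {φ' : E →L[ℝ] ℝ} {V : ℝ → E} {J : Set ℝ} {t d : ℝ}
    (hφ : HasFDerivAt φ φ' (V t)) (hV : ContinuousWithinAt V J t)
    (hO : (fun τ => V τ - V t) =O[𝓝[J] t] fun τ => τ - t)
    (hd : HasDerivWithinAt (fun τ => φ' (V τ)) d J t) :
    HasDerivWithinAt (fun τ => φ (V τ)) d J t := by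
  rw [hasDerivWithinAt_iff_isLittleO] at hd ⊢
  have h1 : (fun τ => φ (V τ) - φ (V t) - φ' (V τ - V t)) =o[𝓝[J] t] fun τ => τ - t :=
    ((hasFDerivAt_iff_isLittleO.1 hφ).comp_tendsto hV).trans_isBigO hO
  refine (h1.add hd).congr_left fun τ => ?_
  simp only [map_sub, smul_eq_mul]
  ring

/-! ### The conductance matrix and the equilibria -/

namespace Microgrid

noncomputable section

set_option linter.unusedSectionVars false

variable {S L : Type*}

theorem incidence_transpose_mulVec [Fintype S] [Fintype L] (G : Microgrid S L) (x : S ⊕ L → ℝ)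
    (e : G.grid.edgeSet) : (G.incidenceᵀ *ᵥ x) e = x (G.head e) - x (G.tail e) := by
  simp [mulVec, dotProduct, incidence, sub_mul, Finset.sum_sub_distrib]

variable [Fintype S] [Fintype L] [DecidableEq S] [DecidableEq L]

theorem Y_isSymm (G : Microgrid S L) : G.Y.IsSymm := by
  classical
  rw [Matrix.IsSymm, Y, transpose_mul, transpose_mul, diagonal_transpose, transpose_transpose,
    Matrix.mul_assoc]

theorem dotProduct_Y_mulVec_nonneg (G : Microgrid S L) (x : S ⊕ L → ℝ) :
    0 ≤ x ⬝ᵥ G.Y *ᵥ x := by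
  classical
  rw [Y, ← mulVec_mulVec, ← mulVec_mulVec, dotProduct_mulVec, ← mulVec_transpose]
  refine Finset.sum_nonneg fun e _ => ?_
  rw [mulVec_diagonal]
  have := G.r_pos e
  nlinarith [mul_nonneg (inv_nonneg.2 this.le) (mul_self_nonneg ((G.incidenceᵀ *ᵥ x) e))]

/-- The conductance form vanishes only on constant vectors. -/
theorem eq_of_dotProduct_Y_mulVec_eq_zero (G : Microgrid S L) {x : S ⊕ L → ℝ}
    (hx : x ⬝ᵥ G.Y *ᵥ x = 0) (i j : S ⊕ L) : x i = x j := by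
  classical
  rw [Y, ← mulVec_mulVec, ← mulVec_mulVec, dotProduct_mulVec, ← mulVec_transpose] at hx
  have hnn : ∀ e, 0 ≤ (G.incidenceᵀ *ᵥ x) e * ((G.r e)⁻¹ * (G.incidenceᵀ *ᵥ x) e) := fun e => by
    have := G.r_pos e
    nlinarith [mul_nonneg (inv_nonneg.2 this.le) (mul_self_nonneg ((G.incidenceᵀ *ᵥ x) e))]
  simp only [dotProduct, mulVec_diagonal] at hx
  rw [Finset.sum_eq_zero_iff_of_nonneg fun e _ => hnn e] at hx
  have hadj : ∀ a b, G.grid.Adj a b → x a = x b := by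
    intro a b hab
    set e : G.grid.edgeSet := ⟨s(a, b), hab⟩
    have h0 := hx e (Finset.mem_univ e)
    have hr := (inv_pos.2 (G.r_pos e)).ne'
    have h1 : (G.incidenceᵀ *ᵥ x) e = 0 := by
      rcases mul_eq_zero.1 h0 with h | h
      · exact h
      · exact (mul_eq_zero.1 h).resolve_left hr
    rw [incidence_transpose_mulVec, sub_eq_zero] at h1
    have h2 : s(a, b) = s(G.tail e, G.head e) := G.edge_eq e
    rcases Sym2.eq_iff.1 h2 with ⟨ha, hb⟩ | ⟨ha, hb⟩
    · rw [ha, hb, h1]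
    · rw [ha, hb, h1]
  obtain ⟨p⟩ := G.grid_connected.preconnected i j
  induction p with
  | nil => rfl
  | cons h _ ih => exact (hadj _ _ h).trans ih

theorem sum_Y_mulVec (G : Microgrid S L) (x : S ⊕ L → ℝ) : ∑ i, (G.Y *ᵥ x) i = 0 := by
  classical
  have h1 : G.incidenceᵀ *ᵥ (1 : S ⊕ L → ℝ) = 0 := by
    funext e
    rw [incidence_transpose_mulVec]
    simp
  have : (1 : S ⊕ L → ℝ) ⬝ᵥ G.Y *ᵥ x = 0 := by
    rw [Y, ← mulVec_mulVec, ← mulVec_mulVec, dotProduct_mulVec, ← mulVec_transpose, h1,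
      zero_dotProduct]
  simpa [dotProduct] using this

theorem Y_mulVec_inl (G : Microgrid S L) (V : S ⊕ L → ℝ) (i : S) :
    (G.Y *ᵥ V) (Sum.inl i) = (G.Yss *ᵥ src V + G.Ysl *ᵥ load V) i := by
  simp [mulVec, dotProduct, Fintype.sum_sum_type, Yss, Ysl, toBlocks₁₁, toBlocks₁₂, src, load]

theorem Y_mulVec_inr (G : Microgrid S L) (V : S ⊕ L → ℝ) (j : L) :
    (G.Y *ᵥ V) (Sum.inr j) = (G.Yls *ᵥ src V + G.Yll *ᵥ load V) j := by
  simp [mulVec, dotProduct, Fintype.sum_sum_type, Yls, Yll, toBlocks₂₁, toBlocks₂₂, src, load]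

theorem Y_eq_fromBlocks (G : Microgrid S L) : G.Y = fromBlocks G.Yss G.Ysl G.Yls G.Yll :=
  (fromBlocks_toBlocks _).symm

theorem Ysl_conjTranspose (G : Microgrid S L) : G.Yslᴴ = G.Yls := by
  ext i j
  exact congrFun (congrFun G.Y_isSymm (Sum.inr i)) (Sum.inl j)

/-- A source vector extended by zero to the loads has the same form value. If that is zero, the
extension is constant on the connected grid, and its value at any load is zero. -/
theorem Yss_posDef [Nonempty L] (G : Microgrid S L) : G.Yss.PosDef := by
  refine .of_dotProduct_mulVec_pos ?_ fun x hx => ?_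
  · ext i j
    exact congrFun (congrFun G.Y_isSymm (Sum.inl i)) (Sum.inl j)
  · have hform : star x ⬝ᵥ G.Yss *ᵥ x = Sum.elim x 0 ⬝ᵥ G.Y *ᵥ Sum.elim x (0 : L → ℝ) := by
      simp [Y_eq_fromBlocks, fromBlocks_mulVec]
    rw [hform]
    refine lt_of_le_of_ne (G.dotProduct_Y_mulVec_nonneg _) fun h0 => hx ?_
    funext i
    simpa using G.eq_of_dotProduct_Y_mulVec_eq_zero h0.symm (Sum.inl i)
      (Sum.inr (Classical.arbitrary L))

theorem Yll_posDef (G : Microgrid S L) : G.Yll.PosDef := by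
  obtain ⟨s⟩ := G.comm_connected.nonempty
  refine .of_dotProduct_mulVec_pos ?_ fun x hx => ?_
  · ext i j
    exact congrFun (congrFun G.Y_isSymm (Sum.inr i)) (Sum.inr j)
  · have hform : star x ⬝ᵥ G.Yll *ᵥ x = Sum.elim 0 x ⬝ᵥ G.Y *ᵥ Sum.elim (0 : S → ℝ) x := by
      simp [Y_eq_fromBlocks, fromBlocks_mulVec]
    rw [hform]
    refine lt_of_le_of_ne (G.dotProduct_Y_mulVec_nonneg _) fun h0 => hx ?_
    funext i
    simpa using G.eq_of_dotProduct_Y_mulVec_eq_zero h0.symm (Sum.inr i) (Sum.inl s)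

/-- With balanced load currents, the power balance compares the actual with the steady-state
source injections. -/
theorem powerBalance_eq (G : Microgrid S L) {V : S ⊕ L → ℝ} (hV : G.currentBalance V = 0) :
    G.powerBalance V = G.sourcePower V - G.steadyPower V := by
  have hI : G.loadCurrent (load V) = G.Yll *ᵥ load V + G.Yls *ᵥ src V := by
    have := sub_eq_zero.1 ((sub_sub _ _ _).symm.trans hV)
    exact this
  have hdet : IsUnit G.Yll.det := (isUnit_iff_isUnit_det _).1 G.Yll_posDef.isUnit
  have hinv : G.Ysl * G.Yll⁻¹ * G.Yll = G.Ysl := by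
    rw [Matrix.mul_assoc, nonsing_inv_mul _ hdet, Matrix.mul_one]
  have hcur : G.Yred *ᵥ src V + (G.Ysl * G.Yll⁻¹) *ᵥ G.loadCurrent (load V)
      = G.Yss *ᵥ src V + G.Ysl *ᵥ load V := by
    rw [hI, Yred, sub_mulVec, mulVec_add, mulVec_mulVec, mulVec_mulVec, hinv]
    abel
  rw [powerBalance, sourcePower, ← mul_add, hcur]

theorem loadCurrent_nonpos (G : Microgrid S L) {Vl : L → ℝ} (h : ∀ j, 0 < Vl j) (j : L) :
    G.loadCurrent Vl j ≤ 0 := by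
  simp only [loadCurrent, Pi.add_apply, Pi.sub_apply, mulVec_diagonal]
  have h1 := mul_nonneg (G.Ystar_nonneg j) (h j).le
  have h2 := mul_nonneg_of_nonpos_of_nonpos (neg_nonpos.2 (inv_nonneg.2 (h j).le)) (G.Pstar_nonpos j)
  linarith [G.Istar_nonpos j]

theorem sourcePower_eq_steadyPower (G : Microgrid S L) {V : S ⊕ L → ℝ} (hV : V ∈ G.equilibria) :
    G.sourcePower V = G.steadyPower V := by
  rw [← sub_eq_zero, ← G.powerBalance_eq hV.2.1, hV.2.2]

/-- At an equilibrium the source injections are proportional to the controller parameters. -/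
theorem exists_sourcePower_eq_mul (G : Microgrid S L) {V : S ⊕ L → ℝ} (hV : V ∈ G.equilibria) :
    ∃ κ : ℝ, 0 ≤ κ ∧ ∀ i, G.sourcePower V i = κ * G.C i := by
  refine ⟨-((∑ j, G.loadCurrent (load V) j) / ∑ j, (src V j)⁻¹ * G.C j), ?_, fun i => ?_⟩
  · rw [neg_nonneg]
    refine div_nonpos_of_nonpos_of_nonneg
      (Finset.sum_nonpos fun j _ => G.loadCurrent_nonpos (fun j => hV.1 _) j)
      (Finset.sum_nonneg fun j _ => mul_nonneg (inv_nonneg.2 (hV.1 _).le) (G.C_pos j).le)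
  · rw [G.sourcePower_eq_steadyPower hV, steadyPower]
    ring

/-- Conversely, balanced load currents and source injections proportional to the controller
parameters characterise equilibria. -/
theorem mem_equilibria_of_sourcePower_eq_mul (G : Microgrid S L) {V : S ⊕ L → ℝ}
    (hpos : V ∈ posOrthant (S ⊕ L)) (hcur : G.currentBalance V = 0) {κ : ℝ}
    (hκ : ∀ i, G.sourcePower V i = κ * G.C i) : V ∈ G.equilibria := by
  refine ⟨hpos, hcur, ?_⟩
  rw [G.powerBalance_eq hcur, sub_eq_zero]
  have hpos' : ∀ i, 0 < src V i := fun i => hpos _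
  have hsrc : ∀ i, (G.Y *ᵥ V) (Sum.inl i) = κ * ((src V i)⁻¹ * G.C i) := by
    intro i
    have h1 := hκ i
    rw [sourcePower, Pi.mul_apply, ← Y_mulVec_inl] at h1
    have := (hpos' i).ne'
    field_simp
    linarith
  have hload : ∀ j, (G.Y *ᵥ V) (Sum.inr j) = G.loadCurrent (load V) j := by
    intro j
    have h1 := congrFun hcur j
    simp only [currentBalance, Pi.sub_apply, Pi.zero_apply] at h1
    rw [Y_mulVec_inr, Pi.add_apply]
    linarith
  -- Zero total current is the scalar equation that determines `κ` from the load currents.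
  have hsum := G.sum_Y_mulVec V
  simp only [Fintype.sum_sum_type, hsrc, hload, ← Finset.mul_sum] at hsum
  obtain ⟨s⟩ := G.comm_connected.nonempty
  have hden : 0 < ∑ j, (src V j)⁻¹ * G.C j :=
    Finset.sum_pos (fun j _ => mul_pos (inv_pos.2 (hpos' j)) (G.C_pos j)) ⟨s, Finset.mem_univ s⟩
  funext i
  have hκ' : (∑ j, G.loadCurrent (load V) j) / ∑ j, (src V j)⁻¹ * G.C j = -κ := by
    rw [div_eq_iff hden.ne']
    linarith
  rw [hκ, steadyPower, hκ']
  ring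

/-! ### Positive definiteness of the Hessian -/

/-- The matrix of the quadratic part of the energy function. -/
def energyMatrix (G : Microgrid S L) : Matrix (S ⊕ L) (S ⊕ L) ℝ :=
  G.Y + fromBlocks 0 0 0 (diagonal G.Ystar)

/-- The coefficients of the logarithms in the energy function. -/
def logCoeff (G : Microgrid S L) (Vbar : S ⊕ L → ℝ) : S ⊕ L → ℝ :=
  Sum.elim (G.sourcePower Vbar) G.Pstar

/-- The Hessian of the energy function is positive definite at `V̄`. -/
theorem hessian_pos [Nonempty L] (G : Microgrid S L) {Vbar : S ⊕ L → ℝ}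
    (hVbar : Vbar ∈ G.equilibria) (hcond : G.MainCondition Vbar) {d : S ⊕ L → ℝ} (hd : d ≠ 0) :
    0 < d ⬝ᵥ (G.energyMatrix + diagonal fun i => (Vbar i ^ 2)⁻¹ * G.logCoeff Vbar i) *ᵥ d := by
  obtain ⟨κ, hκ0, hκ⟩ := G.exists_sourcePower_eq_mul hVbar
  set A := G.Yss + diagonal fun i => (src Vbar i ^ 2)⁻¹ * G.sourcePower Vbar i with hA
  set D := G.Yll + diagonal G.Ystar + diagonal fun i => (load Vbar i ^ 2)⁻¹ * G.Pstar i with hD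
  have hAdef : A.PosDef := by
    refine G.Yss_posDef.add_posSemidef (PosSemidef.diagonal fun i => ?_)
    have := G.C_pos i
    simp only [Pi.zero_apply, hκ]
    positivity
  have hSchur : (D - G.Yslᴴ * A⁻¹ * G.Ysl).PosDef := by
    rw [Ysl_conjTranspose]
    exact hcond
  have hM : G.energyMatrix + diagonal (fun i => (Vbar i ^ 2)⁻¹ * G.logCoeff Vbar i)
      = fromBlocks A G.Ysl G.Yslᴴ D := by
    rw [energyMatrix, Y_eq_fromBlocks, Ysl_conjTranspose, hA, hD]
    ext (i | i) (j | j) <;> simp [diagonal_apply, logCoeff, src, load]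
  have : Invertible A := hAdef.isUnit.invertible
  have key := schur_complement_eq₁₁ G.Ysl D (d ∘ Sum.inl) (d ∘ Sum.inr) hAdef.1
  rw [Sum.elim_comp_inl_inr, ← dotProduct_mulVec, ← dotProduct_mulVec, ← dotProduct_mulVec] at key
  rw [hM]
  change 0 < star d ⬝ᵥ _
  rw [key]
  -- Completing the square leaves an `A`-form plus the Schur form of the load part; the first is
  -- strict when the load part vanishes, the second otherwise.
  by_cases hy : d ∘ Sum.inr = 0
  · have hx : d ∘ Sum.inl ≠ 0 := by
      intro hx
      apply hd
      rw [← Sum.elim_comp_inl_inr d, hx, hy]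
      funext i
      cases i <;> rfl
    rw [hy]
    simpa using hAdef.dotProduct_mulVec_pos hx
  · exact add_pos_of_nonneg_of_pos (hAdef.posSemidef.dotProduct_mulVec_nonneg _)
      (hSchur.dotProduct_mulVec_pos hy)

/-! ### The vector field and its dissipation -/

/-- The source injections relative to the controller parameters. -/
def normalizedPower (G : Microgrid S L) (V : S ⊕ L → ℝ) : S → ℝ :=
  fun i => (G.C i)⁻¹ * G.sourcePower V i

/-- The rate at which the Bregman function decreases along solutions. -/
def dissipation (G : Microgrid S L) (V : S ⊕ L → ℝ) : ℝ :=
  G.normalizedPower V ⬝ᵥ G.Lc *ᵥ G.normalizedPower V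

/-- The right-hand side of the differential equation solved for `V̇_s`. -/
def vectorField (G : Microgrid S L) (V : S ⊕ L → ℝ) : S → ℝ :=
  fun i => -((G.C i)⁻¹ * (src V i * (G.Lc *ᵥ G.normalizedPower V) i))

theorem sum_Lc_mulVec (G : Microgrid S L) (u : S → ℝ) : ∑ i, (G.Lc *ᵥ u) i = 0 := by
  classical
  have hsymm : G.Lcᵀ = G.Lc := G.comm.isSymm_lapMatrix ℝ
  have h1 : G.Lc *ᵥ (fun _ => 1) = 0 := G.comm.lapMatrix_mulVec_const_eq_zero
  have : (fun _ => (1 : ℝ)) ⬝ᵥ G.Lc *ᵥ u = 0 := by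
    rw [dotProduct_mulVec, ← mulVec_transpose, hsymm, h1, zero_dotProduct]
  simpa [dotProduct] using this

theorem Lc_posSemidef (G : Microgrid S L) : G.Lc.PosSemidef := by
  classical
  exact G.comm.posSemidef_lapMatrix ℝ

theorem dissipation_nonneg (G : Microgrid S L) (V : S ⊕ L → ℝ) : 0 ≤ G.dissipation V :=
  G.Lc_posSemidef.dotProduct_mulVec_nonneg _

/-- A positive semidefinite form vanishes only on the kernel of its matrix, and the Laplacian kernel
of a connected graph consists of constants; so the source powers are proportional to `C`. -/
theorem mem_equilibria_of_dissipation_eq_zero (G : Microgrid S L) {V : S ⊕ L → ℝ}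
    (hpos : V ∈ posOrthant (S ⊕ L)) (hcur : G.currentBalance V = 0)
    (hV : G.dissipation V = 0) : V ∈ G.equilibria := by
  classical
  obtain ⟨s⟩ := G.comm_connected.nonempty
  have h1 : G.Lc *ᵥ G.normalizedPower V = 0 :=
    (G.Lc_posSemidef.dotProduct_mulVec_zero_iff _).1 hV
  have h2 := (G.comm.lapMatrix_mulVec_eq_zero_iff_forall_reachable).1 h1
  refine G.mem_equilibria_of_sourcePower_eq_mul hpos hcur (κ := G.normalizedPower V s) fun i => ?_
  rw [← h2 i s (G.comm_connected.preconnected i s), normalizedPower]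
  have := (G.C_pos i).ne'
  field_simp

theorem diagonal_C_mulVec_vectorField (G : Microgrid S L) (V : S ⊕ L → ℝ) :
    diagonal G.C *ᵥ G.vectorField V =
      -((diagonal (src V) * G.Lc * diagonal (fun i => (G.C i)⁻¹)) *ᵥ G.sourcePower V) := by
  have hu : diagonal (fun i => (G.C i)⁻¹) *ᵥ G.sourcePower V = G.normalizedPower V := by
    funext i
    rw [mulVec_diagonal, normalizedPower]
  funext i
  rw [← mulVec_mulVec, ← mulVec_mulVec, hu, mulVec_diagonal, Pi.neg_apply, mulVec_diagonal,
    vectorField]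
  have := (G.C_pos i).ne'
  field_simp

theorem eq_vectorField_iff (G : Microgrid S L) (V : S ⊕ L → ℝ) (dVs : S → ℝ) :
    diagonal G.C *ᵥ dVs =
      -((diagonal (src V) * G.Lc * diagonal (fun i => (G.C i)⁻¹)) *ᵥ G.sourcePower V) ↔
    dVs = G.vectorField V := by
  rw [← diagonal_C_mulVec_vectorField]
  refine ⟨fun h => ?_, fun h => by rw [h]⟩
  funext i
  have := congrFun h i
  rw [mulVec_diagonal, mulVec_diagonal] at this
  exact mul_left_cancel₀ (G.C_pos i).ne' this

end

end Microgrid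

/-! ### The gradient of the Bregman function -/

/-- The continuous linear functional `d ↦ w ⬝ᵥ d`. -/
noncomputable def dotProductCLM {N : Type*} [Fintype N] (w : N → ℝ) : (N → ℝ) →L[ℝ] ℝ :=
  ∑ i, w i • ContinuousLinearMap.proj i

theorem dotProductCLM_apply {N : Type*} [Fintype N] (w d : N → ℝ) :
    dotProductCLM w d = w ⬝ᵥ d := by
  simp [dotProductCLM, dotProduct]

theorem hasStrictFDerivAt_dotProduct {N : Type*} [Fintype N] (w V : N → ℝ) :
    HasStrictFDerivAt (fun V => w ⬝ᵥ V) (dotProductCLM w) V := by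
  simpa only [← dotProductCLM_apply] using (dotProductCLM w).hasStrictFDerivAt

/-- Derivative of the quadratic form of a symmetric matrix. -/
theorem hasFDerivAt_dotProduct_mulVec {N : Type*} [Fintype N] {A : Matrix N N ℝ} (hA : A.IsSymm)
    (V : N → ℝ) :
    HasFDerivAt (fun V => (1 / 2) * (V ⬝ᵥ A *ᵥ V)) (dotProductCLM (A *ᵥ V)) V := by
  have h := (HasFDerivAt.fun_sum (u := Finset.univ) fun i _ =>
    (ContinuousLinearMap.hasFDerivAt (ContinuousLinearMap.proj (R := ℝ) (φ := fun _ : N => ℝ) i)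
      (x := V)).mul (hasStrictFDerivAt_dotProduct (A i) V).hasFDerivAt).const_mul (1 / 2 : ℝ)
  refine h.congr_fderiv ?_
  ext1 d
  have hsymm : V ⬝ᵥ A *ᵥ d = (A *ᵥ V) ⬝ᵥ d := by
    rw [dotProduct_mulVec, ← mulVec_transpose, hA]
  have h1 : ∑ i, V i * (A i ⬝ᵥ d) = (A *ᵥ V) ⬝ᵥ d := hsymm
  have h2 : ∑ i, (A i ⬝ᵥ V) * d i = (A *ᵥ V) ⬝ᵥ d := rfl
  simp [dotProductCLM_apply, Finset.sum_add_distrib, h1, h2]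
  ring

namespace Microgrid

noncomputable section

set_option linter.unusedSectionVars false

variable {S L : Type*} [Fintype S] [Fintype L] [DecidableEq S] [DecidableEq L]

theorem energyMatrix_isSymm (G : Microgrid S L) : G.energyMatrix.IsSymm := by
  refine G.Y_isSymm.add ?_
  rw [Matrix.IsSymm, fromBlocks_transpose]
  simp

theorem energyMatrix_mulVec_inl (G : Microgrid S L) (V : S ⊕ L → ℝ) (i : S) :
    (G.energyMatrix *ᵥ V) (Sum.inl i) = (G.Yss *ᵥ src V + G.Ysl *ᵥ load V) i := by
  rw [energyMatrix, add_mulVec, Pi.add_apply, Y_mulVec_inl, fromBlocks_mulVec]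
  simp

theorem energyMatrix_mulVec_inr (G : Microgrid S L) (V : S ⊕ L → ℝ) (j : L) :
    (G.energyMatrix *ᵥ V) (Sum.inr j) =
      (G.Yls *ᵥ src V + G.Yll *ᵥ load V) j + G.Ystar j * load V j := by
  rw [energyMatrix, add_mulVec, Pi.add_apply, Y_mulVec_inr, fromBlocks_mulVec]
  simp [mulVec_diagonal, load]

/-- The gradient of the Bregman function. -/
def gradient (G : Microgrid S L) (Vbar V : S ⊕ L → ℝ) : S ⊕ L → ℝ :=
  fun i => (G.energyMatrix *ᵥ V) i - (V i)⁻¹ * G.logCoeff Vbar i - Sum.elim (0 : S → ℝ) G.Istar i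

theorem gradient_inl (G : Microgrid S L) (Vbar V : S ⊕ L → ℝ) (i : S) :
    G.gradient Vbar V (Sum.inl i) =
      (G.Yss *ᵥ src V + G.Ysl *ᵥ load V) i - (src V i)⁻¹ * G.sourcePower Vbar i := by
  simp only [gradient, energyMatrix_mulVec_inl, logCoeff, Sum.elim_inl, Pi.zero_apply, sub_zero, src]

/-- The load equations say exactly that the Bregman function is critical in the load directions. -/
theorem gradient_inr (G : Microgrid S L) (Vbar V : S ⊕ L → ℝ) (j : L) :
    G.gradient Vbar V (Sum.inr j) = -G.currentBalance V j := by
  simp only [gradient, energyMatrix_mulVec_inr, logCoeff, Sum.elim_inr, currentBalance, loadCurrent,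
    Pi.add_apply, Pi.sub_apply, mulVec_diagonal, load]
  ring

theorem energy_eq (G : Microgrid S L) (Vbar V : S ⊕ L → ℝ) :
    G.energy Vbar V =
      (1 / 2) * (V ⬝ᵥ G.energyMatrix *ᵥ V) - ∑ i, G.logCoeff Vbar i * Real.log (V i) := by
  simp only [energy, energyMatrix, Fintype.sum_sum_type, logCoeff, Sum.elim_inl, Sum.elim_inr, src,
    load]
  ring

theorem hasFDerivAt_energy (G : Microgrid S L) (Vbar : S ⊕ L → ℝ) {V : S ⊕ L → ℝ}
    (hV : ∀ i, V i ≠ 0) :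
    HasFDerivAt (G.energy Vbar)
      (dotProductCLM fun i => (G.energyMatrix *ᵥ V) i - (V i)⁻¹ * G.logCoeff Vbar i) V := by
  have hlog := HasFDerivAt.fun_sum (u := Finset.univ) fun i _ =>
    ((ContinuousLinearMap.hasFDerivAt (ContinuousLinearMap.proj (R := ℝ)
      (φ := fun _ : S ⊕ L => ℝ) i) (x := V)).log (hV i)).const_mul (G.logCoeff Vbar i)
  have h := (hasFDerivAt_dotProduct_mulVec G.energyMatrix_isSymm V).sub hlog
  refine (h.congr_of_eventuallyEq (Eventually.of_forall fun W => G.energy_eq Vbar W)).congr_fderiv ?_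
  ext1 d
  simp only [_root_.sub_apply, dotProductCLM_apply, dotProduct, sub_mul,
    Finset.sum_sub_distrib, sub_right_inj, _root_.sum_apply]
  refine Finset.sum_congr rfl fun i _ => ?_
  simp
  ring

theorem gradient_self (G : Microgrid S L) {Vbar : S ⊕ L → ℝ} (hVbar : Vbar ∈ G.equilibria) :
    G.gradient Vbar Vbar = 0 := by
  funext i
  rcases i with i | j
  · have hi : src Vbar i ≠ 0 := (hVbar.1 _).ne'
    rw [gradient_inl, sourcePower, Pi.mul_apply, inv_mul_cancel_left₀ hi, sub_self, Pi.zero_apply]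
  · rw [gradient_inr, hVbar.2.1]
    simp

/-- The gradient of the energy at an equilibrium is `col(0, I_l^*)`, so the linear correction merely
restores the constant-current loads. -/
theorem bregman_eq (G : Microgrid S L) {Vbar : S ⊕ L → ℝ} (hVbar : Vbar ∈ G.equilibria)
    (V : S ⊕ L → ℝ) :
    G.bregman Vbar V =
      G.energy Vbar V - G.energy Vbar Vbar - Sum.elim (0 : S → ℝ) G.Istar ⬝ᵥ (V - Vbar) := by
  rw [bregman, (G.hasFDerivAt_energy Vbar fun i => (hVbar.1 i).ne').fderiv, dotProductCLM_apply]
  congr 2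
  funext i
  exact sub_eq_zero.1 (congrFun (G.gradient_self hVbar) i)

theorem bregman_self (G : Microgrid S L) (Vbar : S ⊕ L → ℝ) : G.bregman Vbar Vbar = 0 := by
  simp [bregman]

theorem hasFDerivAt_bregman (G : Microgrid S L) {Vbar : S ⊕ L → ℝ} (hVbar : Vbar ∈ G.equilibria)
    {V : S ⊕ L → ℝ} (hV : V ∈ posOrthant (S ⊕ L)) :
    HasFDerivAt (G.bregman Vbar) (dotProductCLM (G.gradient Vbar V)) V := by
  have h := ((G.hasFDerivAt_energy Vbar fun i => (hV i).ne').sub_const (G.energy Vbar Vbar)).sub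
    (((dotProductCLM (Sum.elim (0 : S → ℝ) G.Istar)).hasFDerivAt (x := V)).sub_const
      (dotProductCLM (Sum.elim (0 : S → ℝ) G.Istar) Vbar))
  refine (h.congr_of_eventuallyEq (Eventually.of_forall fun W => ?_)).congr_fderiv ?_
  · simp only [G.bregman_eq hVbar, Pi.sub_apply, dotProductCLM_apply, dotProduct_sub]
  · ext1 d
    simp only [_root_.sub_apply, dotProductCLM_apply, ← sub_dotProduct]
    rfl

/-- The mean Hessian of the energy function between `V` and `W`. -/
def meanHessian (G : Microgrid S L) (Vbar V W : S ⊕ L → ℝ) : Matrix (S ⊕ L) (S ⊕ L) ℝ :=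
  G.energyMatrix + diagonal fun i => (V i * W i)⁻¹ * G.logCoeff Vbar i

/-- The identity `1/v - 1/w = -(v - w)/(v w)` makes the secant formula exact, so no Hessian has to
be integrated along a segment. -/
theorem gradient_sub_gradient (G : Microgrid S L) (Vbar : S ⊕ L → ℝ) {V W : S ⊕ L → ℝ}
    (hV : V ∈ posOrthant (S ⊕ L)) (hW : W ∈ posOrthant (S ⊕ L)) :
    G.gradient Vbar V - G.gradient Vbar W = G.meanHessian Vbar V W *ᵥ (V - W) := by
  funext i
  have h1 := (hV i).ne'
  have h2 := (hW i).ne'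
  simp only [meanHessian, add_mulVec, mulVec_sub, Pi.add_apply, Pi.sub_apply, mulVec_diagonal,
    gradient]
  field_simp
  ring

/-! ### Strong convexity near the equilibrium and the sublevel sets -/

/-- On the closed ball of radius `ρ` the energy function is strongly convex with modulus `m`. -/
structure StronglyConvexBall (G : Microgrid S L) (Vbar : S ⊕ L → ℝ) (ρ m : ℝ) : Prop where
  radius_pos : 0 < ρ
  modulus_pos : 0 < m
  subset_posOrthant : Metric.closedBall Vbar ρ ⊆ posOrthant (S ⊕ L)
  le_form : ∀ V ∈ Metric.closedBall Vbar ρ, ∀ W ∈ Metric.closedBall Vbar ρ, ∀ d : S ⊕ L → ℝ,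
    m * ‖d‖ ^ 2 ≤ d ⬝ᵥ G.meanHessian Vbar V W *ᵥ d

theorem exists_stronglyConvexBall [Nonempty L] (G : Microgrid S L) {Vbar : S ⊕ L → ℝ}
    (hVbar : Vbar ∈ G.equilibria) (hcond : G.MainCondition Vbar) :
    ∃ ρ m, G.StronglyConvexBall Vbar ρ m := by
  obtain ⟨m, hm, hform⟩ := exists_pos_mul_sq_norm_le_dotProduct _
    fun d hd => G.hessian_pos hVbar hcond hd
  -- The mean Hessian differs from the Hessian at `V̄` only on the diagonal. Once the total
  -- deviation is below `m / 2`, half of the modulus survives.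
  set err : (S ⊕ L → ℝ) × (S ⊕ L → ℝ) → ℝ := fun p =>
    ∑ i, |(p.1 i * p.2 i)⁻¹ * G.logCoeff Vbar i - (Vbar i ^ 2)⁻¹ * G.logCoeff Vbar i| with herr
  have hcont : ContinuousAt err (Vbar, Vbar) := by
    refine tendsto_finsetSum _ fun i _ => ?_
    have hi : Vbar i * Vbar i ≠ 0 := mul_ne_zero (hVbar.1 i).ne' (hVbar.1 i).ne'
    have h1 : ContinuousAt (fun p : (S ⊕ L → ℝ) × (S ⊕ L → ℝ) => p.1 i * p.2 i) (Vbar, Vbar) := by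
      fun_prop
    exact (((h1.inv₀ hi).mul continuousAt_const).sub continuousAt_const).abs
  have herr0 : err (Vbar, Vbar) < m / 2 := by
    simp only [herr, ← sq, sub_self, abs_zero, Finset.sum_const_zero]
    positivity
  have hpos : ∀ᶠ V in 𝓝 Vbar, V ∈ posOrthant (S ⊕ L) :=
    eventually_all.2 fun i =>
      (continuous_apply i).continuousAt.eventually (lt_mem_nhds (hVbar.1 i))
  have hev := hcont.eventually (gt_mem_nhds herr0)
  rw [nhds_prod_eq, eventually_prod_self_iff'] at hev
  obtain ⟨t, ht, hterr⟩ := hev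
  obtain ⟨ρ, hρ, hball⟩ := Metric.nhds_basis_closedBall.mem_iff.1 (inter_mem ht hpos)
  refine ⟨ρ, m / 2, hρ, by positivity, fun V hV => (hball hV).2, fun V hV W hW d => ?_⟩
  have hlt := hterr V (hball hV).1 W (hball hW).1
  have hsplit : d ⬝ᵥ G.meanHessian Vbar V W *ᵥ d =
      d ⬝ᵥ (G.energyMatrix + diagonal fun i => (Vbar i ^ 2)⁻¹ * G.logCoeff Vbar i) *ᵥ d +
      ∑ i, ((V i * W i)⁻¹ * G.logCoeff Vbar i - (Vbar i ^ 2)⁻¹ * G.logCoeff Vbar i) * d i ^ 2 := by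
    simp only [meanHessian, add_mulVec, dotProduct_add, add_assoc, add_right_inj]
    simp only [dotProduct, mulVec_diagonal, ← Finset.sum_add_distrib]
    exact Finset.sum_congr rfl fun i _ => by ring
  have hbound : -(err (V, W) * ‖d‖ ^ 2) ≤
      ∑ i, ((V i * W i)⁻¹ * G.logCoeff Vbar i - (Vbar i ^ 2)⁻¹ * G.logCoeff Vbar i) * d i ^ 2 := by
    rw [herr, Finset.sum_mul, ← Finset.sum_neg_distrib]
    refine Finset.sum_le_sum fun i _ => ?_
    have h1 : d i ^ 2 ≤ ‖d‖ ^ 2 := by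
      rw [← sq_abs]
      exact pow_le_pow_left₀ (abs_nonneg _) (norm_le_pi_norm d i) 2
    set x := (V i * W i)⁻¹ * G.logCoeff Vbar i - (Vbar i ^ 2)⁻¹ * G.logCoeff Vbar i
    nlinarith [neg_abs_le x, abs_nonneg x, sq_nonneg (d i)]
  nlinarith [hform d, sq_nonneg ‖d‖]

namespace StronglyConvexBall

variable {G : Microgrid S L} {Vbar : S ⊕ L → ℝ} {ρ m : ℝ}

theorem le_gradient_sub (h : G.StronglyConvexBall Vbar ρ m) {V W : S ⊕ L → ℝ}
    (hV : V ∈ Metric.closedBall Vbar ρ) (hW : W ∈ Metric.closedBall Vbar ρ) :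
    m * ‖V - W‖ ^ 2 ≤ (V - W) ⬝ᵥ (G.gradient Vbar V - G.gradient Vbar W) := by
  rw [G.gradient_sub_gradient Vbar (h.subset_posOrthant hV) (h.subset_posOrthant hW)]
  exact h.le_form V hV W hW _

theorem center_mem (h : G.StronglyConvexBall Vbar ρ m) : Vbar ∈ Metric.closedBall Vbar ρ :=
  Metric.mem_closedBall_self h.radius_pos.le

/-- Quantitative growth of the Bregman function along rays from `V̄`. -/
theorem bregman_ray_add_le (h : G.StronglyConvexBall Vbar ρ m) (hVbar : Vbar ∈ G.equilibria)
    {V : S ⊕ L → ℝ} (hV : V ∈ Metric.closedBall Vbar ρ) {s : ℝ} (hs : s ∈ Icc (0 : ℝ) 1) :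
    G.bregman Vbar (Vbar + s • (V - Vbar)) + m / 2 * ‖V - Vbar‖ ^ 2 * (1 - s ^ 2) ≤
      G.bregman Vbar V := by
  set d := V - Vbar with hd
  have hmem : ∀ t ∈ Icc (0 : ℝ) 1, Vbar + t • d ∈ Metric.closedBall Vbar ρ := fun t ht =>
    (convex_closedBall Vbar ρ).add_smul_sub_mem h.center_mem hV ht
  have hderiv : ∀ t ∈ Icc (0 : ℝ) 1,
      HasDerivAt (fun t : ℝ => G.bregman Vbar (Vbar + t • d) - m / 2 * ‖d‖ ^ 2 * t ^ 2)
        (G.gradient Vbar (Vbar + t • d) ⬝ᵥ d - m * ‖d‖ ^ 2 * t) t := by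
    intro t ht
    have hline : HasDerivAt (fun t : ℝ => Vbar + t • d) d t := by
      simpa using ((hasDerivAt_id t).smul_const d).const_add Vbar
    have h1 := (G.hasFDerivAt_bregman hVbar (h.subset_posOrthant (hmem t ht))).comp_hasDerivAt t hline
    rw [dotProductCLM_apply] at h1
    refine (h1.sub ((hasDerivAt_pow 2 t).const_mul (m / 2 * ‖d‖ ^ 2))).congr_deriv ?_
    push_cast
    ring
  -- Strong monotonicity against `V̄`, where the gradient vanishes, gives the slope bound multiplied
  -- by `t`; dividing by `t` is possible in the interior.
  have hmono : MonotoneOn (fun t : ℝ => G.bregman Vbar (Vbar + t • d) - m / 2 * ‖d‖ ^ 2 * t ^ 2)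
      (Icc 0 1) := by
    refine monotoneOn_of_hasDerivWithinAt_nonneg (convex_Icc 0 1)
      (fun t ht => (hderiv t ht).continuousAt.continuousWithinAt)
      (fun t ht => (hderiv t (interior_subset ht)).hasDerivWithinAt) (fun t ht => ?_)
    rw [interior_Icc] at ht
    have h1 := h.le_gradient_sub (hmem t (Ioo_subset_Icc_self ht)) h.center_mem
    rw [add_sub_cancel_left, G.gradient_self hVbar, sub_zero, smul_dotProduct, norm_smul,
      Real.norm_of_nonneg ht.1.le, dotProduct_comm, smul_eq_mul] at h1
    have h2 : t * (m * ‖d‖ ^ 2 * t) ≤ t * (G.gradient Vbar (Vbar + t • d) ⬝ᵥ d) := by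
      linarith
    linarith [le_of_mul_le_mul_left h2 ht.1]
  have := hmono hs (right_mem_Icc.2 zero_le_one) hs.2
  simp only [one_smul, hd, add_sub_cancel] at this
  rw [hd]
  linarith

theorem le_bregman (h : G.StronglyConvexBall Vbar ρ m) (hVbar : Vbar ∈ G.equilibria)
    {V : S ⊕ L → ℝ} (hV : V ∈ Metric.closedBall Vbar ρ) :
    m / 2 * ‖V - Vbar‖ ^ 2 ≤ G.bregman Vbar V := by
  have := h.bregman_ray_add_le hVbar hV (left_mem_Icc.2 zero_le_one)
  simpa [bregman_self] using this

theorem continuousOn_bregman (h : G.StronglyConvexBall Vbar ρ m) (hVbar : Vbar ∈ G.equilibria) :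
    ContinuousOn (G.bregman Vbar) (Metric.closedBall Vbar ρ) := fun _ hV =>
  (G.hasFDerivAt_bregman hVbar (h.subset_posOrthant hV)).continuousAt.continuousWithinAt

theorem mem_ball_of_bregman_le (h : G.StronglyConvexBall Vbar ρ m) (hVbar : Vbar ∈ G.equilibria)
    {c : ℝ} (hc : c < m / 2 * ρ ^ 2) {V : S ⊕ L → ℝ} (hV : V ∈ Metric.closedBall Vbar ρ)
    (hVc : G.bregman Vbar V ≤ c) : V ∈ Metric.ball Vbar ρ := by
  rw [Metric.mem_ball, dist_eq_norm]
  by_contra! hge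
  have h1 := h.le_bregman hVbar hV
  have h2 : m / 2 * ρ ^ 2 ≤ m / 2 * ‖V - Vbar‖ ^ 2 := by
    have := h.modulus_pos
    have := h.radius_pos
    gcongr
  linarith

/-- For small levels the sublevel set around `V̄` is the part of the sublevel set in the ball. -/
theorem sublevel_eq (h : G.StronglyConvexBall Vbar ρ m) (hVbar : Vbar ∈ G.equilibria)
    {c : ℝ} (hc0 : 0 < c) (hc : c < m / 2 * ρ ^ 2) :
    G.sublevel Vbar c = {V ∈ Metric.closedBall Vbar ρ | G.bregman Vbar V ≤ c} := by
  have hF : Vbar ∈ {V | V ∈ posOrthant (S ⊕ L) ∧ G.bregman Vbar V ≤ c} :=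
    ⟨hVbar.1, by rw [bregman_self]; exact hc0.le⟩
  apply Subset.antisymm
  · have hsub : G.sublevel Vbar c ⊆ Metric.ball Vbar ρ := by
      -- On the sphere of radius `ρ` the Bregman function is at least `m / 2 * ρ ^ 2 > c`. The open
      -- ball and the complement of the closed ball therefore separate the sublevel set.
      refine isPreconnected_connectedComponentIn.subset_left_of_subset_union Metric.isOpen_ball
        Metric.isClosed_closedBall.isOpen_compl
        (disjoint_compl_right.mono_left Metric.ball_subset_closedBall) (fun V hV => ?_)
        ⟨Vbar, mem_connectedComponentIn hF, Metric.mem_ball_self h.radius_pos⟩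
      by_cases hVb : V ∈ Metric.closedBall Vbar ρ
      · exact Or.inl (h.mem_ball_of_bregman_le hVbar hc hVb (connectedComponentIn_subset _ _ hV).2)
      · exact Or.inr hVb
    exact fun V hV => ⟨Metric.ball_subset_closedBall (hsub hV), (connectedComponentIn_subset _ _ hV).2⟩
  · refine IsPreconnected.subset_connectedComponentIn ?_ ?_ ?_
    · refine isPreconnected_of_forall Vbar fun V hV =>
        ⟨segment ℝ Vbar V, fun W hW => ?_, left_mem_segment ℝ _ _, right_mem_segment ℝ _ _,
          (convex_segment _ _).isPreconnected⟩
      rw [segment_eq_image'] at hW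
      obtain ⟨s, hs, rfl⟩ := hW
      refine ⟨(convex_closedBall Vbar ρ).add_smul_sub_mem h.center_mem hV.1 hs, ?_⟩
      have h1 := h.bregman_ray_add_le hVbar hV.1 hs
      have h2 : 0 ≤ m / 2 * ‖V - Vbar‖ ^ 2 * (1 - s ^ 2) := by
        have := h.modulus_pos
        have : 0 ≤ 1 - s ^ 2 := by nlinarith [hs.1, hs.2]
        positivity
      simp only
      linarith [hV.2]
    · exact ⟨h.center_mem, hF.2⟩
    · exact fun V hV => ⟨h.subset_posOrthant hV.1, hV.2⟩

theorem isCompact_sublevel (h : G.StronglyConvexBall Vbar ρ m) (hVbar : Vbar ∈ G.equilibria)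
    {c : ℝ} (hc0 : 0 < c) (hc : c < m / 2 * ρ ^ 2) : IsCompact (G.sublevel Vbar c) := by
  rw [h.sublevel_eq hVbar hc0 hc]
  exact (isCompact_closedBall Vbar ρ).of_isClosed_subset
    ((h.continuousOn_bregman hVbar).preimage_isClosed_of_isClosed Metric.isClosed_closedBall
      isClosed_Iic) fun V hV => hV.1

theorem sublevel_mem_nhds (h : G.StronglyConvexBall Vbar ρ m) (hVbar : Vbar ∈ G.equilibria)
    {c : ℝ} (hc0 : 0 < c) (hc : c < m / 2 * ρ ^ 2) : G.sublevel Vbar c ∈ 𝓝 Vbar := by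
  rw [h.sublevel_eq hVbar hc0 hc]
  have h1 : ∀ᶠ V in 𝓝 Vbar, G.bregman Vbar V < c :=
    (G.hasFDerivAt_bregman hVbar hVbar.1).continuousAt.eventually
      (gt_mem_nhds (by rw [bregman_self]; exact hc0))
  filter_upwards [h1, Metric.closedBall_mem_nhds Vbar h.radius_pos] with V hV hVb using ⟨hVb, hV.le⟩

end StronglyConvexBall

/-! ### Smoothness and the dissipation identity -/

theorem contDiff_sourcePower (G : Microgrid S L) : ContDiff ℝ 1 G.sourcePower := by
  refine contDiff_pi.2 fun i => ?_
  simp only [sourcePower, Pi.mul_apply, Pi.add_apply, mulVec, dotProduct, src, load]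
  fun_prop

theorem contDiff_normalizedPower (G : Microgrid S L) : ContDiff ℝ 1 G.normalizedPower :=
  contDiff_pi.2 fun i => contDiff_const.mul ((contDiff_pi.1 G.contDiff_sourcePower) i)

theorem contDiff_dissipation (G : Microgrid S L) : ContDiff ℝ 1 G.dissipation := by
  have := G.contDiff_normalizedPower
  unfold dissipation dotProduct mulVec dotProduct
  fun_prop

theorem contDiff_vectorField (G : Microgrid S L) : ContDiff ℝ 1 G.vectorField := by
  have := G.contDiff_normalizedPower
  refine contDiff_pi.2 fun i => ?_
  simp only [vectorField, mulVec, dotProduct, src]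
  fun_prop

theorem contDiffOn_gradient (G : Microgrid S L) (Vbar : S ⊕ L → ℝ) :
    ContDiffOn ℝ 1 (G.gradient Vbar) (posOrthant (S ⊕ L)) := by
  refine contDiffOn_pi.2 fun i => ?_
  simp only [gradient, mulVec, dotProduct]
  have hinv : ContDiffOn ℝ 1 (fun V : S ⊕ L → ℝ => (V i)⁻¹) (posOrthant (S ⊕ L)) :=
    ContDiffOn.inv (by fun_prop) fun V hV => (hV i).ne'
  fun_prop

/-- The dissipation is the decrease of the Bregman function in the direction of the vector field. -/
theorem sum_gradient_mul_vectorField (G : Microgrid S L) {Vbar V : S ⊕ L → ℝ}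
    (hVbar : Vbar ∈ G.equilibria) (hV : V ∈ posOrthant (S ⊕ L)) :
    ∑ i, G.gradient Vbar V (Sum.inl i) * G.vectorField V i = -G.dissipation V := by
  obtain ⟨κ, -, hκ⟩ := G.exists_sourcePower_eq_mul hVbar
  -- The voltage factors cancel. The term with `κ` then disappears in the sum, since the entries of
  -- `L_c u` add up to zero.
  have hterm : ∀ i, G.gradient Vbar V (Sum.inl i) * G.vectorField V i =
      κ * (G.Lc *ᵥ G.normalizedPower V) i
        - G.normalizedPower V i * (G.Lc *ᵥ G.normalizedPower V) i := by
    intro i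
    have hC := (G.C_pos i).ne'
    have hi : src V i ≠ 0 := (hV _).ne'
    have hu : G.normalizedPower V i = (G.C i)⁻¹ * (src V i * (G.Yss *ᵥ src V + G.Ysl *ᵥ load V) i) :=
      rfl
    rw [gradient_inl, hκ, vectorField]
    set z := (G.Lc *ᵥ G.normalizedPower V) i
    rw [hu]
    field_simp
    ring
  rw [Finset.sum_congr rfl fun i _ => hterm i, Finset.sum_sub_distrib, ← Finset.mul_sum,
    sum_Lc_mulVec, mul_zero, zero_sub]
  rfl

/-! ### The load manifold and the reduced differential equation -/

/-- The voltages near `V̄` that satisfy the load equations. -/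
def loadManifold (G : Microgrid S L) (Vbar : S ⊕ L → ℝ) (ρ : ℝ) : Set (S ⊕ L → ℝ) :=
  {V | V ∈ Metric.ball Vbar ρ ∧ G.currentBalance V = 0}

/-- Strict differentiability is what local surjectivity of the load equations requires. -/
theorem hasStrictFDerivAt_gradient_apply (G : Microgrid S L) (Vbar : S ⊕ L → ℝ) {V : S ⊕ L → ℝ}
    {i : S ⊕ L} (hV : V i ≠ 0) :
    HasStrictFDerivAt (fun W => G.gradient Vbar W i)
      (dotProductCLM (G.meanHessian Vbar V V i)) V := by
  have h1 := hasStrictFDerivAt_dotProduct (G.energyMatrix i) V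
  have h2 := ((hasStrictDerivAt_inv hV).comp_hasStrictFDerivAt V
    (ContinuousLinearMap.proj (R := ℝ) (φ := fun _ : S ⊕ L => ℝ) i).hasStrictFDerivAt).mul_const
      (G.logCoeff Vbar i)
  refine ((h1.sub h2).sub_const (Sum.elim (0 : S → ℝ) G.Istar i)).congr_fderiv ?_
  ext1 d
  have h3 : dotProductCLM (G.meanHessian Vbar V V i) d = (G.meanHessian Vbar V V *ᵥ d) i :=
    dotProductCLM_apply _ _
  rw [h3, meanHessian, add_mulVec, Pi.add_apply, mulVec_diagonal]
  simp only [_root_.sub_apply, dotProductCLM_apply, mulVec]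
  simp
  ring

namespace StronglyConvexBall

variable {G : Microgrid S L} {Vbar : S ⊕ L → ℝ} {ρ m : ℝ}

/-- On the load manifold the voltages depend Lipschitz-continuously on the source voltages. -/
theorem exists_norm_sub_le (h : G.StronglyConvexBall Vbar ρ m) :
    ∃ K : NNReal, ∀ V ∈ G.loadManifold Vbar ρ, ∀ W ∈ G.loadManifold Vbar ρ,
      ‖V - W‖ ≤ K * ‖src V - src W‖ := by
  obtain ⟨K, hK⟩ := ((G.contDiffOn_gradient Vbar).mono h.subset_posOrthant).exists_lipschitzOnWith
    one_ne_zero (convex_closedBall Vbar ρ) (isCompact_closedBall Vbar ρ)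
  have hm := h.modulus_pos
  -- Only the `card S` source terms survive in the monotonicity inequality, each at most `‖src V -
  -- src W‖ * (K * ‖V - W‖)`; one then cancels `‖V - W‖` and divides by `m`.
  refine ⟨⟨Fintype.card S * K / m, by positivity⟩, fun V hV W hW => ?_⟩
  have hVb := Metric.ball_subset_closedBall hV.1
  have hWb := Metric.ball_subset_closedBall hW.1
  have h1 := h.le_gradient_sub hVb hWb
  have h2 : (V - W) ⬝ᵥ (G.gradient Vbar V - G.gradient Vbar W) ≤
      Fintype.card S * (‖src V - src W‖ * (K * ‖V - W‖)) := by
    simp only [dotProduct, Fintype.sum_sum_type, Pi.sub_apply, gradient_inr, hV.2, hW.2,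
      Pi.zero_apply, neg_zero, sub_self, mul_zero, Finset.sum_const_zero, add_zero]
    rw [← nsmul_eq_mul, ← Finset.card_univ]
    refine Finset.sum_le_card_nsmul _ _ _ fun i _ => ?_
    refine (le_abs_self _).trans ?_
    rw [abs_mul]
    have h3 := norm_le_pi_norm (src V - src W) i
    have h4 := (norm_le_pi_norm (G.gradient Vbar V - G.gradient Vbar W) (Sum.inl i)).trans
      (hK.norm_sub_le hVb hWb)
    exact mul_le_mul h3 h4 (abs_nonneg _) (norm_nonneg _)
  rcases (norm_nonneg (V - W)).eq_or_lt with h0 | h0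
  · rw [← h0]
    exact mul_nonneg (NNReal.coe_nonneg _) (norm_nonneg _)
  · have h5 : m * ‖V - W‖ ≤ Fintype.card S * K * ‖src V - src W‖ := by
      refine le_of_mul_le_mul_right ?_ h0
      linarith
    change ‖V - W‖ ≤ Fintype.card S * K / m * ‖src V - src W‖
    rw [div_mul_eq_mul_div, le_div_iff₀ hm]
    linarith

/-- The load equations are solvable for all source voltages near those of a solution. -/
theorem src_image_mem_nhds (h : G.StronglyConvexBall Vbar ρ m) {V : S ⊕ L → ℝ}
    (hV : V ∈ G.loadManifold Vbar ρ) : src '' G.loadManifold Vbar ρ ∈ 𝓝 (src V) := by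
  have hVb := Metric.ball_subset_closedBall hV.1
  have hpos := h.subset_posOrthant hVb
  set Φ : (S ⊕ L → ℝ) → S ⊕ L → ℝ := fun W =>
    Sum.elim (src W) fun j => G.gradient Vbar W (Sum.inr j) with hΦ
  set Φ' : (S ⊕ L → ℝ) →L[ℝ] S ⊕ L → ℝ := ContinuousLinearMap.pi fun k =>
    Sum.elim (fun i => ContinuousLinearMap.proj (Sum.inl i))
      (fun j => dotProductCLM (G.meanHessian Vbar V V (Sum.inr j))) k with hΦ'
  have hderiv : HasStrictFDerivAt Φ Φ' V := by
    refine hasStrictFDerivAt_pi.2 fun k => ?_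
    rcases k with i | j
    · exact (ContinuousLinearMap.proj (R := ℝ) (φ := fun _ : S ⊕ L => ℝ)
        (Sum.inl i)).hasStrictFDerivAt
    · exact G.hasStrictFDerivAt_gradient_apply Vbar (hpos _).ne'
  -- If `d` has zero source part and its Hessian image has zero load part, then `d` is orthogonal to
  -- that image, so definiteness forces `d = 0`. Injectivity is surjectivity in finite dimension.
  have hinj : Function.Injective (Φ' : (S ⊕ L → ℝ) →ₗ[ℝ] S ⊕ L → ℝ) := by
    rw [← LinearMap.ker_eq_bot, LinearMap.ker_eq_bot']
    intro d hd
    have hs : ∀ i, d (Sum.inl i) = 0 := fun i => congrFun hd (Sum.inl i)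
    have hl : ∀ j, (G.meanHessian Vbar V V *ᵥ d) (Sum.inr j) = 0 := fun j =>
      (dotProductCLM_apply _ _).symm.trans (congrFun hd (Sum.inr j))
    have hform := h.le_form V hVb V hVb d
    have hzero : d ⬝ᵥ G.meanHessian Vbar V V *ᵥ d = 0 := by
      rw [dotProduct, Fintype.sum_sum_type]
      simp [hs, hl]
    rw [hzero] at hform
    have hm := h.modulus_pos
    have : ‖d‖ ^ 2 ≤ 0 := by
      by_contra! hlt
      nlinarith
    exact norm_eq_zero.1 (pow_eq_zero_iff two_ne_zero |>.1 (le_antisymm this (sq_nonneg _)))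
  have hsurj : (Φ' : (S ⊕ L → ℝ) →L[ℝ] S ⊕ L → ℝ).range = ⊤ :=
    LinearMap.range_eq_top.2 (LinearMap.injective_iff_surjective.1 hinj)
  have hmap := hderiv.map_nhds_eq_of_surj hsurj
  have himg : Φ '' Metric.ball Vbar ρ ∈ 𝓝 (Φ V) := by
    rw [← hmap]
    exact image_mem_map (Metric.isOpen_ball.mem_nhds hV.1)
  have hΦV : Φ V = Sum.elim (src V) 0 := by
    funext k
    rcases k with i | j
    · rfl
    · simp [hΦ, gradient_inr, hV.2]
  have hcont : Continuous fun y : S → ℝ => (Sum.elim y 0 : S ⊕ L → ℝ) := by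
    refine continuous_pi fun k => ?_
    rcases k with i | j
    · exact continuous_apply i
    · exact continuous_const
  rw [hΦV] at himg
  -- The slice of the image over zero load gradient consists of the solvable source voltages.
  filter_upwards [hcont.continuousAt himg] with y hy
  obtain ⟨W, hW, hWy⟩ := hy
  refine ⟨W, ⟨hW, ?_⟩, ?_⟩
  · funext j
    have := congrFun hWy (Sum.inr j)
    simpa [hΦ, gradient_inr] using this
  · funext i
    exact congrFun hWy (Sum.inl i)

/-- A globally Lipschitz function that computes the load voltages on the load manifold. -/
theorem exists_lipschitz_load (h : G.StronglyConvexBall Vbar ρ m) :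
    ∃ (K : NNReal) (η : (S → ℝ) → L → ℝ), LipschitzWith K η ∧
      ∀ V ∈ G.loadManifold Vbar ρ, η (src V) = load V := by
  obtain ⟨K, hK⟩ := h.exists_norm_sub_le
  have hinj : InjOn src (G.loadManifold Vbar ρ) := by
    intro V hV W hW hVW
    have := hK V hV W hW
    rw [hVW, sub_self, norm_zero, mul_zero] at this
    exact sub_eq_zero.1 (norm_le_zero_iff.1 this)
  set inv := Function.invFunOn (src : (S ⊕ L → ℝ) → S → ℝ) (G.loadManifold Vbar ρ)
  have hinv : ∀ V ∈ G.loadManifold Vbar ρ, inv (src V) = V := fun V hV => hinj.leftInvOn_invFunOn hV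
  have hlip : LipschitzOnWith K (fun y => load (inv y)) (src '' G.loadManifold Vbar ρ) := by
    refine LipschitzOnWith.of_dist_le_mul ?_
    rintro _ ⟨V, hV, rfl⟩ _ ⟨W, hW, rfl⟩
    rw [hinv V hV, hinv W hW, dist_eq_norm, dist_eq_norm]
    refine le_trans ?_ (hK V hV W hW)
    exact (pi_norm_le_iff_of_nonneg (norm_nonneg _)).2 fun j => norm_le_pi_norm (V - W) (Sum.inr j)
  obtain ⟨η, hη, heq⟩ := hlip.extend_pi
  exact ⟨K, η, hη, fun V hV =>
    (heq ⟨V, hV, rfl⟩).symm.trans (congrArg load (hinv V hV))⟩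

/-- A bounded and globally Lipschitz vector field on the source voltages, together with a Lipschitz
function giving the load voltages, that governs the dynamics on the load manifold. -/
theorem exists_reduced_vectorField (h : G.StronglyConvexBall Vbar ρ m) :
    ∃ (K B : NNReal) (F : (S → ℝ) → S → ℝ) (η : (S → ℝ) → L → ℝ), LipschitzWith K F ∧
      (∀ y, ‖F y‖ ≤ B) ∧ Continuous η ∧
      ∀ V ∈ G.loadManifold Vbar ρ, η (src V) = load V ∧ F (src V) = G.vectorField V := by
  obtain ⟨K, η, hη, hηV⟩ := h.exists_lipschitz_load
  obtain ⟨K', hK'⟩ := (G.contDiff_vectorField.contDiffOn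
    (s := Metric.closedBall Vbar ρ)).exists_lipschitzOnWith one_ne_zero
    (convex_closedBall Vbar ρ) (isCompact_closedBall Vbar ρ)
  obtain ⟨B, hB⟩ := (isCompact_closedBall Vbar ρ).exists_bound_of_continuousOn
    G.contDiff_vectorField.continuous.continuousOn
  obtain ⟨f, hf, hfB, hfeq⟩ := hK'.exists_bounded_extension (B := B.toNNReal)
    fun V hV => (hB V hV).trans (Real.le_coe_toNNReal B)
  have hcol : LipschitzWith (max 1 K) fun y : S → ℝ => (Sum.elim y (η y) : S ⊕ L → ℝ) := by
    rw [lipschitzWith_iff_dist_le_mul]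
    intro y z
    refine (dist_pi_le_iff (by positivity)).2 fun k => ?_
    rcases k with i | j
    · refine (dist_le_pi_dist y z i).trans (le_mul_of_one_le_left dist_nonneg ?_)
      exact_mod_cast le_max_left 1 K
    · refine ((dist_le_pi_dist (η y) (η z) j).trans (hη.dist_le_mul y z)).trans ?_
      gcongr
      exact_mod_cast le_max_right 1 K
  refine ⟨_, B.toNNReal, fun y => f (Sum.elim y (η y)), η, hf.comp hcol, fun y => hfB _,
    hη.continuous, fun V hV => ⟨hηV V hV, ?_⟩⟩
  have hV' : (Sum.elim (src V) (load V) : S ⊕ L → ℝ) = V := Sum.elim_comp_inl_inr V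
  beta_reduce
  rw [hηV V hV, hV']
  exact (hfeq (Metric.ball_subset_closedBall hV.1)).symm

/-! ### Lyapunov decrease and invariance -/

/-- Along trajectories on the load manifold the Bregman function decreases at the rate given by the
dissipation, although the load voltages are not known to be differentiable. -/
theorem hasDerivWithinAt_bregman (h : G.StronglyConvexBall Vbar ρ m) (hVbar : Vbar ∈ G.equilibria)
    {V : ℝ → S ⊕ L → ℝ} {J : Set ℝ} {t : ℝ} (ht : t ∈ J)
    (hV : ∀ τ ∈ J, V τ ∈ G.loadManifold Vbar ρ)
    (hder : HasDerivWithinAt (fun τ => src (V τ)) (G.vectorField (V t)) J t) :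
    HasDerivWithinAt (fun τ => G.bregman Vbar (V τ)) (-G.dissipation (V t)) J t := by
  obtain ⟨K, hK⟩ := h.exists_norm_sub_le
  have hpos := h.subset_posOrthant (Metric.ball_subset_closedBall (hV t ht).1)
  have hO : (fun τ => V τ - V t) =O[𝓝[J] t] fun τ => τ - t := by
    refine Asymptotics.IsBigO.trans ?_ hder.hasFDerivWithinAt.isBigO_sub
    refine Asymptotics.IsBigO.of_bound K ?_
    filter_upwards [self_mem_nhdsWithin] with τ hτ using hK _ (hV τ hτ) _ (hV t ht)
  have hcont : ContinuousWithinAt V J t := by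
    have h0 : Tendsto (fun τ => V τ - V t) (𝓝[J] t) (𝓝 0) := by
      refine hO.trans_tendsto ?_
      have : Tendsto (fun τ : ℝ => τ - t) (𝓝 t) (𝓝 (t - t)) := tendsto_id.sub_const t
      rw [sub_self] at this
      exact this.mono_left nhdsWithin_le_nhds
    exact tendsto_sub_nhds_zero_iff.1 h0
  refine (G.hasFDerivAt_bregman hVbar hpos).hasDerivWithinAt_comp_of_isBigO hcont hO ?_
  rw [← G.sum_gradient_mul_vectorField hVbar hpos]
  -- The load components of the gradient vanish at `V t`, so the derivative sees only the
  -- differentiable source part.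
  have hval : ∀ W : S ⊕ L → ℝ, dotProductCLM (G.gradient Vbar (V t)) W =
      ∑ i, G.gradient Vbar (V t) (Sum.inl i) * src W i := by
    intro W
    simp [dotProductCLM_apply, dotProduct, gradient_inr, (hV t ht).2, src]
  simp only [hval]
  exact HasDerivWithinAt.fun_sum fun i _ => ((hasDerivWithinAt_pi.1 hder) i).const_mul _

theorem antitoneOn_bregman (h : G.StronglyConvexBall Vbar ρ m) (hVbar : Vbar ∈ G.equilibria)
    {V : ℝ → S ⊕ L → ℝ} {J : Set ℝ} (hJ : Convex ℝ J)
    (hV : ∀ τ ∈ J, V τ ∈ G.loadManifold Vbar ρ)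
    (hder : ∀ t ∈ J, HasDerivWithinAt (fun τ => src (V τ)) (G.vectorField (V t)) J t) :
    AntitoneOn (fun τ => G.bregman Vbar (V τ)) J :=
  antitoneOn_of_hasDerivWithinAt_nonpos hJ
    (fun t ht => (h.hasDerivWithinAt_bregman hVbar ht hV (hder t ht)).continuousWithinAt)
    (fun t ht => (h.hasDerivWithinAt_bregman hVbar (interior_subset ht) hV
      (hder t (interior_subset ht))).mono interior_subset)
    fun _ _ => neg_nonpos.2 (G.dissipation_nonneg _)

theorem sublevel_subset_ball (h : G.StronglyConvexBall Vbar ρ m) (hVbar : Vbar ∈ G.equilibria)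
    {c : ℝ} (hc0 : 0 < c) (hc : c < m / 2 * ρ ^ 2) :
    G.sublevel Vbar c ⊆ Metric.ball Vbar ρ := by
  rw [h.sublevel_eq hVbar hc0 hc]
  exact fun V hV => h.mem_ball_of_bregman_le hVbar hc hV.1 hV.2

theorem continuousOn_currentBalance (h : G.StronglyConvexBall Vbar ρ m) :
    ContinuousOn G.currentBalance (Metric.closedBall Vbar ρ) := by
  refine continuousOn_pi.2 fun j => ?_
  have h1 := (continuousOn_pi.1 ((G.contDiffOn_gradient Vbar).mono
    h.subset_posOrthant).continuousOn (Sum.inr j)).neg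
  refine h1.congr fun V _ => ?_
  rw [Pi.neg_apply, gradient_inr, neg_neg]

theorem isCompact_sublevel_inter (h : G.StronglyConvexBall Vbar ρ m) (hVbar : Vbar ∈ G.equilibria)
    {c : ℝ} (hc0 : 0 < c) (hc : c < m / 2 * ρ ^ 2) :
    IsCompact {V | V ∈ G.sublevel Vbar c ∧ G.currentBalance V = 0} := by
  have hcomp := h.isCompact_sublevel hVbar hc0 hc
  refine hcomp.of_isClosed_subset (ContinuousOn.preimage_isClosed_of_isClosed
    (h.continuousOn_currentBalance.mono ((h.sublevel_subset_ball hVbar hc0 hc).trans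
      Metric.ball_subset_closedBall)) hcomp.isClosed (isClosed_singleton (x := 0))) fun V hV => hV.1

/-- Trajectories that start in the sublevel set and satisfy the load equations stay there. -/
theorem mem_sublevel_of_mem (h : G.StronglyConvexBall Vbar ρ m) (hVbar : Vbar ∈ G.equilibria)
    {c : ℝ} (hc0 : 0 < c) (hc : c < m / 2 * ρ ^ 2) {V : ℝ → S ⊕ L → ℝ} {T : ℝ}
    (hcont : ContinuousOn V (Icc 0 T)) (h0 : V 0 ∈ G.sublevel Vbar c)
    (hbal : G.currentBalance (V 0) = 0)
    (hnear : ∀ t ∈ Ico 0 T, V t ∈ G.loadManifold Vbar ρ →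
      ∀ᶠ τ in 𝓝[>] t, V τ ∈ G.loadManifold Vbar ρ)
    (hder : ∀ t ∈ Icc 0 T, V t ∈ G.loadManifold Vbar ρ →
      HasDerivWithinAt (fun τ => src (V τ)) (G.vectorField (V t)) (Icc 0 T) t) :
    ∀ t ∈ Icc 0 T, V t ∈ G.sublevel Vbar c ∧ G.currentBalance (V t) = 0 := by
  have hclosed : IsClosed ({t | V t ∈ G.sublevel Vbar c ∧ G.currentBalance (V t) = 0} ∩ Icc 0 T) := by
    rw [inter_comm]
    exact hcont.preimage_isClosed_of_isClosed isClosed_Icc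
      (h.isCompact_sublevel_inter hVbar hc0 hc).isClosed
  -- Continuation in time: the good times form a closed set. From each of them the curve stays on
  -- the load manifold for a while, where the Bregman function cannot increase.
  refine hclosed.Icc_subset_of_forall_mem_nhdsWithin ⟨h0, hbal⟩ ?_
  rintro t ⟨⟨htc, htb⟩, ht⟩
  have htM : V t ∈ G.loadManifold Vbar ρ := ⟨h.sublevel_subset_ball hVbar hc0 hc htc, htb⟩
  have hIoo : Ioo t T ∈ 𝓝[>] t := Ioo_mem_nhdsGT ht.2
  obtain ⟨u, hu, hsub⟩ :=
    mem_nhdsGT_iff_exists_Ioo_subset.1 (inter_mem (hnear t ht htM) hIoo)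
  filter_upwards [Ioo_mem_nhdsGT hu] with τ hτ
  have hM : ∀ σ ∈ Icc t τ, V σ ∈ G.loadManifold Vbar ρ := by
    intro σ hσ
    rcases hσ.1.eq_or_lt with rfl | hlt
    · exact htM
    · exact (hsub ⟨hlt, hσ.2.trans_lt hτ.2⟩).1
  have hτT : τ < T := (hsub hτ).2.2
  have hJ : Icc t τ ⊆ Icc 0 T := Icc_subset_Icc ht.1 hτT.le
  have hanti := h.antitoneOn_bregman hVbar (convex_Icc t τ) hM fun σ hσ =>
    (hder σ (hJ hσ) (hM σ hσ)).mono hJ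
  have hle := hanti (left_mem_Icc.2 hτ.1.le) (right_mem_Icc.2 hτ.1.le) hτ.1.le
  have hMτ := hM τ (right_mem_Icc.2 hτ.1.le)
  rw [h.sublevel_eq hVbar hc0 hc] at htc
  refine ⟨?_, hMτ.2⟩
  rw [h.sublevel_eq hVbar hc0 hc]
  exact ⟨Metric.ball_subset_closedBall hMτ.1, le_trans hle htc.2⟩

end StronglyConvexBall

/-! ### Solutions and the conserved geometric mean -/

theorem currentBalance_eq_zero_iff (G : Microgrid S L) (V : S ⊕ L → ℝ) :
    G.currentBalance V = 0 ↔
      -G.loadCurrent (load V) = -(G.Yls *ᵥ src V + G.Yll *ᵥ load V) := by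
  rw [currentBalance, sub_sub, sub_eq_zero, neg_inj, add_comm]

namespace IsSolutionOn

variable {G : Microgrid S L} {J J' : Set ℝ} {V : ℝ → S ⊕ L → ℝ}

theorem mono (h : G.IsSolutionOn J V) (hJ : J' ⊆ J) : G.IsSolutionOn J' V where
  continuousOn := h.continuousOn.mono hJ
  source t ht := by
    obtain ⟨d, hd, hd'⟩ := h.source t (hJ ht)
    exact ⟨d, hd.mono hJ, hd'⟩
  algebraic t ht := h.algebraic t (hJ ht)

theorem hasDerivWithinAt (h : G.IsSolutionOn J V) {t : ℝ} (ht : t ∈ J) :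
    HasDerivWithinAt (fun τ => src (V τ)) (G.vectorField (V t)) J t := by
  obtain ⟨d, hd, hd'⟩ := h.source t ht
  rwa [(G.eq_vectorField_iff (V t) d).1 hd'] at hd

theorem currentBalance_eq_zero (h : G.IsSolutionOn J V) {t : ℝ} (ht : t ∈ J) :
    G.currentBalance (V t) = 0 :=
  (G.currentBalance_eq_zero_iff _).2 (h.algebraic t ht)

end IsSolutionOn

theorem isSolutionOn_of_hasDerivWithinAt {G : Microgrid S L} {J : Set ℝ} {V : ℝ → S ⊕ L → ℝ}
    (hcont : ContinuousOn V J)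
    (hder : ∀ t ∈ J, HasDerivWithinAt (fun τ => src (V τ)) (G.vectorField (V t)) J t)
    (hbal : ∀ t ∈ J, G.currentBalance (V t) = 0) : G.IsSolutionOn J V where
  continuousOn := hcont
  source t ht := ⟨_, hder t ht, (G.eq_vectorField_iff _ _).2 rfl⟩
  algebraic t ht := (G.currentBalance_eq_zero_iff _).1 (hbal t ht)

theorem geomMean_eq_exp (G : Microgrid S L) {V : S ⊕ L → ℝ} (hV : V ∈ posOrthant (S ⊕ L)) :
    G.geomMean V = Real.exp (∑ i, G.C i * Real.log (src V i)) := by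
  rw [geomMean, Real.exp_sum]
  refine Finset.prod_congr rfl fun i _ => ?_
  rw [Real.rpow_def_of_pos (show 0 < src V i from hV _), mul_comm]

/-- Positive solutions preserve the weighted geometric mean of the source voltages. -/
theorem IsSolutionOn.geomMean_eq {G : Microgrid S L} {V : ℝ → S ⊕ L → ℝ}
    (h : G.IsSolutionOn (Ici 0) V) (hpos : ∀ t, 0 ≤ t → V t ∈ posOrthant (S ⊕ L)) {t : ℝ}
    (ht : 0 ≤ t) : G.geomMean (V t) = G.geomMean (V 0) := by
  have hder : ∀ τ ∈ Ici (0 : ℝ),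
      HasDerivWithinAt (fun τ => ∑ i, G.C i * Real.log (src (V τ) i)) 0 (Ici 0) τ := by
    intro τ hτ
    have h1 := HasDerivWithinAt.fun_sum (u := Finset.univ) fun i _ =>
      (((hasDerivWithinAt_pi.1 (h.hasDerivWithinAt hτ)) i).log
        (hpos τ hτ (Sum.inl i)).ne').const_mul (G.C i)
    refine h1.congr_deriv ?_
    -- The derivative of `∑ C_i ln V_i` is minus the sum of the entries of `L_c u`.
    rw [← neg_zero, ← G.sum_Lc_mulVec (G.normalizedPower (V τ)), ← Finset.sum_neg_distrib]
    refine Finset.sum_congr rfl fun i _ => ?_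
    have hC := (G.C_pos i).ne'
    have hi : src (V τ) i ≠ 0 := (hpos τ hτ (Sum.inl i)).ne'
    rw [vectorField]
    field_simp
  have hconst := constant_of_has_deriv_right_zero (a := 0) (b := t)
    (fun τ hτ => ((hder τ hτ.1).mono Icc_subset_Ici_self).continuousWithinAt)
    (fun τ hτ => (hder τ hτ.1).mono (Ici_subset_Ici.2 hτ.1)) t (right_mem_Icc.2 ht)
  rw [G.geomMean_eq_exp (hpos t ht), G.geomMean_eq_exp (hpos 0 le_rfl)]
  exact congrArg Real.exp hconst

theorem continuousOn_geomMean (G : Microgrid S L) :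
    ContinuousOn G.geomMean (posOrthant (S ⊕ L)) := by
  refine continuousOn_finsetProd _ fun i _ => ?_
  exact ContinuousOn.rpow_const (continuous_apply (Sum.inl i)).continuousOn
    fun V hV => Or.inl (hV (Sum.inl i)).ne'

/-! ### Global existence, uniqueness and convergence -/

namespace StronglyConvexBall

variable {G : Microgrid S L} {Vbar : S ⊕ L → ℝ} {ρ m c : ℝ}

theorem sublevel_subset_posOrthant (h : G.StronglyConvexBall Vbar ρ m)
    (hVbar : Vbar ∈ G.equilibria) (hc0 : 0 < c) (hc : c < m / 2 * ρ ^ 2) :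
    G.sublevel Vbar c ⊆ posOrthant (S ⊕ L) :=
  ((h.sublevel_subset_ball hVbar hc0 hc).trans Metric.ball_subset_closedBall).trans
    h.subset_posOrthant

/-- Solutions that start in the sublevel set stay there. -/
theorem solution_mem_sublevel (h : G.StronglyConvexBall Vbar ρ m) (hVbar : Vbar ∈ G.equilibria)
    (hc0 : 0 < c) (hc : c < m / 2 * ρ ^ 2) {V : ℝ → S ⊕ L → ℝ} {T : ℝ}
    (hV : G.IsSolutionOn (Icc 0 T) V) (h0 : V 0 ∈ G.sublevel Vbar c) {t : ℝ}
    (ht : t ∈ Icc 0 T) : V t ∈ G.sublevel Vbar c := by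
  have h0T : (0 : ℝ) ∈ Icc 0 T := ⟨le_rfl, ht.1.trans ht.2⟩
  refine (h.mem_sublevel_of_mem hVbar hc0 hc hV.continuousOn h0 (hV.currentBalance_eq_zero h0T)
    (fun τ hτ hM => ?_) (fun τ hτ _ => hV.hasDerivWithinAt hτ) t ht).1
  have hIcc : Icc 0 T ∈ 𝓝[>] τ := Icc_mem_nhdsGT_of_mem hτ
  have hcont : ContinuousWithinAt V (Ioi τ) τ :=
    (hV.continuousOn τ (Ico_subset_Icc_self hτ)).mono_of_mem_nhdsWithin hIcc
  filter_upwards [hcont (Metric.isOpen_ball.mem_nhds hM.1), hIcc] with σ hσ hσT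
    using ⟨hσ, hV.currentBalance_eq_zero hσT⟩

/-- Solutions exist for all times from compatible initial conditions in the sublevel set. -/
theorem exists_solution (h : G.StronglyConvexBall Vbar ρ m) (hVbar : Vbar ∈ G.equilibria)
    (hc0 : 0 < c) (hc : c < m / 2 * ρ ^ 2) {V0 : S ⊕ L → ℝ} (hV0 : V0 ∈ G.sublevel Vbar c)
    (hbal : G.currentBalance V0 = 0) :
    ∃ V : ℝ → S ⊕ L → ℝ, V 0 = V0 ∧ G.IsSolutionOn (Ici 0) V := by
  obtain ⟨K, B, F, η, hF, hFB, hη, hred⟩ := h.exists_reduced_vectorField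
  obtain ⟨y, hy0, hy⟩ := exists_forall_hasDerivAt_of_lipschitzWith_of_norm_le hF hFB (src V0)
  have hycont : Continuous y := continuous_iff_continuousAt.2 fun t => (hy t).continuousAt
  set V : ℝ → S ⊕ L → ℝ := fun t => Sum.elim (y t) (η (y t)) with hVdef
  have hsrc : (fun t => src (V t)) = y := rfl
  have hM0 : V0 ∈ G.loadManifold Vbar ρ := ⟨h.sublevel_subset_ball hVbar hc0 hc hV0, hbal⟩
  have hVeq : ∀ W ∈ G.loadManifold Vbar ρ, (Sum.elim (src W) (η (src W)) : S ⊕ L → ℝ) = W := by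
    intro W hW
    rw [(hred W hW).1]
    exact Sum.elim_comp_inl_inr W
  have hV0eq : V 0 = V0 := by
    rw [← hVeq V0 hM0, ← hy0]
  have hVcont : Continuous V := by
    refine continuous_pi fun k => ?_
    rcases k with i | j
    · exact (continuous_apply i).comp hycont
    · exact (continuous_apply j).comp (hη.comp hycont)
  have hder : ∀ t, V t ∈ G.loadManifold Vbar ρ →
      HasDerivAt (fun τ => src (V τ)) (G.vectorField (V t)) t := by
    intro t ht
    rw [← (hred (V t) ht).2]
    exact hy t
  have hmem : ∀ t, 0 ≤ t → V t ∈ G.sublevel Vbar c ∧ G.currentBalance (V t) = 0 := by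
    intro t ht
    refine h.mem_sublevel_of_mem hVbar hc0 hc (T := t) hVcont.continuousOn (hV0eq ▸ hV0)
      (hV0eq ▸ hbal) (fun τ _ hM => ?_) (fun τ _ hM => (hder τ hM).hasDerivWithinAt) t
      (right_mem_Icc.2 ht)
    -- Nearby source voltages come from points `W` of the load manifold, and `η` returns the loads
    -- of `W`; hence the curve itself is on the manifold.
    filter_upwards [nhdsWithin_le_nhds (hycont.continuousAt (h.src_image_mem_nhds hM))] with σ hσ
    obtain ⟨W, hW, hWσ⟩ := hσ
    have : V σ = W := by rw [← hVeq W hW, hWσ]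
    rwa [this]
  refine ⟨V, hV0eq, isSolutionOn_of_hasDerivWithinAt hVcont.continuousOn (fun t ht => ?_)
    fun t ht => (hmem t ht).2⟩
  exact (hder t ⟨h.sublevel_subset_ball hVbar hc0 hc (hmem t ht).1,
    (hmem t ht).2⟩).hasDerivWithinAt

/-- Solutions that start in the sublevel set are unique. -/
theorem solution_unique (h : G.StronglyConvexBall Vbar ρ m) (hVbar : Vbar ∈ G.equilibria)
    (hc0 : 0 < c) (hc : c < m / 2 * ρ ^ 2) {V W : ℝ → S ⊕ L → ℝ} {T : ℝ}
    (hV : G.IsSolutionOn (Icc 0 T) V) (hW : G.IsSolutionOn (Icc 0 T) W)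
    (h0 : V 0 ∈ G.sublevel Vbar c) (hWV : W 0 = V 0) : EqOn W V (Icc 0 T) := by
  obtain ⟨K, B, F, η, hF, hFB, hη, hred⟩ := h.exists_reduced_vectorField
  have manifold : ∀ {U : ℝ → S ⊕ L → ℝ}, G.IsSolutionOn (Icc 0 T) U →
      U 0 ∈ G.sublevel Vbar c → ∀ t ∈ Icc 0 T, U t ∈ G.loadManifold Vbar ρ := fun hU hU0 t ht =>
    ⟨h.sublevel_subset_ball hVbar hc0 hc (h.solution_mem_sublevel hVbar hc0 hc hU hU0 ht),
      hU.currentBalance_eq_zero ht⟩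
  have deriv : ∀ {U : ℝ → S ⊕ L → ℝ}, G.IsSolutionOn (Icc 0 T) U →
      U 0 ∈ G.sublevel Vbar c → ∀ t ∈ Icc 0 T,
      HasDerivWithinAt (fun τ => src (U τ)) (F (src (U t))) (Icc 0 T) t := fun hU hU0 t ht => by
    rw [(hred _ (manifold hU hU0 t ht)).2]
    exact hU.hasDerivWithinAt ht
  have right : ∀ {U : ℝ → S ⊕ L → ℝ}, G.IsSolutionOn (Icc 0 T) U →
      U 0 ∈ G.sublevel Vbar c → ∀ t ∈ Ico 0 T,
      HasDerivWithinAt (fun τ => src (U τ)) (F (src (U t))) (Ici t) t := fun hU hU0 t ht =>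
    (deriv hU hU0 t (Ico_subset_Icc_self ht)).mono_of_mem_nhdsWithin (Icc_mem_nhdsGE_of_mem ht)
  have hW0 : W 0 ∈ G.sublevel Vbar c := hWV ▸ h0
  -- Both source trajectories solve the same globally Lipschitz equation; the loads then agree
  -- through `η`.
  have hsrc : EqOn (fun τ => src (W τ)) (fun τ => src (V τ)) (Icc 0 T) :=
    ODE_solution_unique (v := fun _ => F) (fun _ => hF)
      (fun t ht => (deriv hW hW0 t ht).continuousWithinAt) (right hW hW0)
      (fun t ht => (deriv hV h0 t ht).continuousWithinAt) (right hV h0) (congrArg src hWV)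
  intro t ht
  have hs : src (W t) = src (V t) := hsrc ht
  have hl : load (W t) = load (V t) := by
    rw [← (hred _ (manifold hW hW0 t ht)).1, ← (hred _ (manifold hV h0 t ht)).1, hs]
  funext k
  rcases k with i | j
  · exact congrFun hs i
  · exact congrFun hl j

/-- Along solutions in the sublevel set the dissipation tends to `0`. -/
theorem tendsto_dissipation (h : G.StronglyConvexBall Vbar ρ m) (hVbar : Vbar ∈ G.equilibria)
    {V : ℝ → S ⊕ L → ℝ} (hV : G.IsSolutionOn (Ici 0) V)
    (hM : ∀ t ∈ Ici (0 : ℝ), V t ∈ G.loadManifold Vbar ρ) :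
    Tendsto (fun t => G.dissipation (V t)) atTop (𝓝 0) := by
  have hball : ∀ t ∈ Ici (0 : ℝ), V t ∈ Metric.closedBall Vbar ρ := fun t ht =>
    Metric.ball_subset_closedBall (hM t ht).1
  obtain ⟨K₁, hK₁⟩ := (G.contDiff_dissipation.contDiffOn
    (s := Metric.closedBall Vbar ρ)).exists_lipschitzOnWith one_ne_zero
    (convex_closedBall Vbar ρ) (isCompact_closedBall Vbar ρ)
  obtain ⟨K₂, hK₂⟩ := h.exists_norm_sub_le
  obtain ⟨B, hB⟩ := (isCompact_closedBall Vbar ρ).exists_bound_of_continuousOn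
    G.contDiff_vectorField.continuous.continuousOn
  have hsrc : LipschitzOnWith B.toNNReal (fun τ => src (V τ)) (Ici 0) :=
    (convex_Ici 0).lipschitzOnWith_of_nnnorm_hasDerivWithin_le
      (fun t ht => hV.hasDerivWithinAt ht) fun t ht => by
        rw [← NNReal.coe_le_coe, coe_nnnorm]
        exact (hB _ (hball t ht)).trans (Real.le_coe_toNNReal B)
  have hVlip : LipschitzOnWith (K₂ * B.toNNReal) V (Ici 0) := by
    refine LipschitzOnWith.of_dist_le_mul fun s hs t ht => ?_
    rw [dist_eq_norm, NNReal.coe_mul, mul_assoc]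
    refine (hK₂ _ (hM s hs) _ (hM t ht)).trans ?_
    gcongr
    rw [← dist_eq_norm]
    exact hsrc.dist_le_mul s hs t ht
  -- Barbalat's lemma applies with lower bound `0`, as the Bregman function is nonnegative on the
  -- ball.
  refine tendsto_zero_of_dissipation (f := fun t => G.bregman Vbar (V t)) (b := 0)
    (fun t ht => h.hasDerivWithinAt_bregman hVbar ht hM (hV.hasDerivWithinAt ht))
    (fun t _ => G.dissipation_nonneg _) (hK₁.comp hVlip hball) fun t ht => ?_
  refine le_trans ?_ (h.le_bregman hVbar (hball t ht))
  have := h.modulus_pos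
  positivity

/-- Solutions that start in the sublevel set approach the equilibria in it. -/
theorem tendsto_infEDist (h : G.StronglyConvexBall Vbar ρ m) (hVbar : Vbar ∈ G.equilibria)
    (hc0 : 0 < c) (hc : c < m / 2 * ρ ^ 2) {V : ℝ → S ⊕ L → ℝ} (hV : G.IsSolutionOn (Ici 0) V)
    (hmem : ∀ t, 0 ≤ t → V t ∈ G.sublevel Vbar c) :
    Tendsto (fun t => Metric.infEDist (V t)
      (G.equilibria ∩ G.sublevel Vbar c ∩ G.meanSet (G.sublevel Vbar c) (V 0))) atTop (𝓝 0) := by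
  have hsub := h.sublevel_subset_posOrthant hVbar hc0 hc
  have hcompact : IsCompact (G.meanSet (G.sublevel Vbar c) (V 0)) := by
    have hcomp := h.isCompact_sublevel_inter hVbar hc0 hc
    refine hcomp.of_isClosed_subset ?_ fun W hW => ⟨hW.1, hW.2.1⟩
    have := ContinuousOn.preimage_isClosed_of_isClosed
      (G.continuousOn_geomMean.mono fun W (hW : W ∈ {W | W ∈ G.sublevel Vbar c ∧
        G.currentBalance W = 0}) => hsub hW.1) hcomp.isClosed
      (isClosed_singleton (x := G.geomMean (V 0)))
    convert this using 1
    ext W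
    exact and_assoc.symm
  have hlim := tendsto_infEDist_of_tendsto_zero hcompact
    G.contDiff_dissipation.continuous.continuousOn (V := V)
    (fun t ht => ⟨hmem t ht, hV.currentBalance_eq_zero ht,
      hV.geomMean_eq (fun τ hτ => hsub (hmem τ hτ)) ht⟩)
    (h.tendsto_dissipation hVbar hV fun t ht =>
      ⟨h.sublevel_subset_ball hVbar hc0 hc (hmem t ht), hV.currentBalance_eq_zero ht⟩)
  refine tendsto_of_tendsto_of_tendsto_of_le_of_le tendsto_const_nhds hlim (fun _ => zero_le)
    fun t => Metric.infEDist_anti ?_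
  rintro W ⟨hW, hW0⟩
  exact ⟨⟨G.mem_equilibria_of_dissipation_eq_zero (hsub hW.1) hW.2.1 hW0, hW.1⟩, hW⟩

end StronglyConvexBall

end

end Microgrid

theorem theorem1 {S L : Type*} [Fintype S] [Fintype L] [DecidableEq S] [DecidableEq L]
    [Nonempty L] (G : Microgrid S L) (Vbar : S ⊕ L → ℝ)
    (hVbar : Vbar ∈ G.equilibria) (hcond : G.MainCondition Vbar) :
    ∃ Λ : Set (S ⊕ L → ℝ),
      (∃ c : ℝ, 0 < c ∧ Λ = G.sublevel Vbar c) ∧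
      IsCompact Λ ∧ Λ ⊆ Microgrid.posOrthant (S ⊕ L) ∧ Λ ∈ 𝓝 Vbar ∧
      -- existence for all times, from every initial condition compatible with the load equations
      (∀ V0 ∈ Λ, G.currentBalance V0 = 0 →
        ∃ V : ℝ → S ⊕ L → ℝ, V 0 = V0 ∧ G.IsSolutionOn (Ici 0) V) ∧
      -- every solution on a bounded interval that starts in `Λ` extends to all times
      (∀ (T : ℝ) (V : ℝ → S ⊕ L → ℝ), 0 < T → G.IsSolutionOn (Ico 0 T) V → V 0 ∈ Λ →
        ∃ W : ℝ → S ⊕ L → ℝ, G.IsSolutionOn (Ici 0) W ∧ EqOn W V (Ico 0 T)) ∧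
      -- every solution that starts in `Λ` stays there, with positive voltages, preserves the
      -- weighted geometric mean of the source voltages, and converges
      (∀ V : ℝ → S ⊕ L → ℝ, G.IsSolutionOn (Ici 0) V → V 0 ∈ Λ →
        (∀ t, 0 ≤ t → V t ∈ Λ ∧ (∀ i, 0 < V t i) ∧ G.geomMean (V t) = G.geomMean (V 0)) ∧
        Tendsto (fun t => Metric.infEDist (V t) (G.equilibria ∩ Λ ∩ G.meanSet Λ (V 0)))
          atTop (𝓝 0)) := by
  obtain ⟨ρ, m, h⟩ := G.exists_stronglyConvexBall hVbar hcond
  have hm := h.modulus_pos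
  have hρ := h.radius_pos
  obtain ⟨c, hc0, hc⟩ := exists_between (show 0 < m / 2 * ρ ^ 2 by positivity)
  have hsub := h.sublevel_subset_posOrthant hVbar hc0 hc
  refine ⟨G.sublevel Vbar c, ⟨c, hc0, rfl⟩, h.isCompact_sublevel hVbar hc0 hc, hsub,
    h.sublevel_mem_nhds hVbar hc0 hc, fun V0 hV0 hbal => h.exists_solution hVbar hc0 hc hV0 hbal,
    fun T V hT hV h0 => ?_, fun V hV h0 => ?_⟩
  -- The extension is the global solution from `V 0`; uniqueness on each `[0, t]` with `t < T`
  -- identifies it with `V`.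
  · obtain ⟨W, hW0, hW⟩ := h.exists_solution hVbar hc0 hc h0
      (hV.currentBalance_eq_zero (left_mem_Ico.2 hT))
    refine ⟨W, hW, fun t ht => ?_⟩
    exact h.solution_unique hVbar hc0 hc (hV.mono (Icc_subset_Ico_right ht.2))
      (hW.mono Icc_subset_Ici_self) h0 hW0 (right_mem_Icc.2 ht.1)
  · have hmem : ∀ t, 0 ≤ t → V t ∈ G.sublevel Vbar c := fun t ht =>
      h.solution_mem_sublevel hVbar hc0 hc (hV.mono Icc_subset_Ici_self) h0 (right_mem_Icc.2 ht)
    exact ⟨fun t ht => ⟨hmem t ht, hsub (hmem t ht),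
      hV.geomMean_eq (fun τ hτ => hsub (hmem τ hτ)) ht⟩,
      h.tendsto_infEDist hVbar hc0 hc hV hmem⟩
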